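/- Let $F=(V;E,A)$ be a finite mixed graph with undirected edges $E$ and directed arcs $A$ (parallel edges and arcs allowed, no loops), $M$ a matroid on a finite set $S$ with rank function $r_M$, and $\pi:S\to V$ a map. A mixed path is a path with distinct vertices in which edges may be traversed in both directions and arcs only forwards. For $X\subseteq V$, let $W(X)$ be the set of vertices that lie in $X$ or from which some vertex of $X$ is reachable by a mixed path, let $S_X=\pi^{-1}(X)$, and let $d_A^-(X)$ be the number of arcs from $V\setminus X$ to $X$. A bi-set is a pair $X=(X_O,X_I)$ with $X_I\subseteq X_O\subseteq V$, and $d_A^-(X)$ is then the number of arcs from $V\setminus X_O$ to $X_I$. A strong component $C$ is a maximal subgraph in which any two vertices are reachable from each other; $V(C)$ is its vertex set. A subpartition of $U\subseteq V$ is a finite family $\mathcal P=\{X_1,\dots,X_t\}$ of pairwise disjoint nonempty subsets of $U$, and $e_E(\mathcal P)$ is the number of edges of $E$ that connect two distinct members of $\mathcal P$ or a member of $\mathcal P$ with $V\setminus\bigcup_j X_j$. A mixed arborescence with root $r$ is a subgraph $T$ of $F$ whose underlying undirected graph is a tree and in which, for every $u\in V(T)$, there is exactly one mixed path from $r$ to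 $u$. A maximal $M$-independent packing of mixed arborescences is a family $(T_s)_{s\in S}$ of pairwise edge- and arc-disjoint mixed arborescences such that $T_s$ has root $\pi(s)$ and, for each $v\in V$, the set $\{s\in S: v\in V(T_s)\}$ is independent in $M$ and has exactly $r_M(S_{W(\{v\})})$ elements. The map $\pi$ is $M$-independent if $\pi^{-1}(v)$ is independent in $M$ for each $v\in V$. For a strong component $C$ and nonempty $Z\subseteq V(C)$ put $$f_C(Z)=\max\{\,r_M(S_{W(V(C))})-r_M(S_X)-d_A^-(X)\;:\; Z\subseteq X\subseteq V,\ X\setminus Z=W(Y)\text{ for some }Y\subseteq W(V(C))\setminus V(C)\,\}.$$ Then the following three statements are equivalent. (i) There is a maximal $M$-independent packing of mixed arborescences. (ii) $\pi$ is $M$-independent, and for every strong component $C$ and every finite family of bi-sets $X^1,\dots,X^t$ such that $\mathcal P=\{(X^1)_I,\dots,(X^t)_I\}$ is a subpartition of $V(C)$ and, for each $q$, $(X^q)_O\setminus (X^q)_I=W(Y)$ for some $Y\subseteq W(V(C))\setminus V(C)$, $$e_E(\mathcal P)+\sum_{q=1}^t d_A^-(X^q)\ \ge\ \sum_{q=1}^t\bigl(r_M(S_{W(V(C))})-r_M(S_{(X^q)_O})\bigr).$$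 (iii) $\pi$ is $M$-independent, and for every strong component $C$ and every subpartition $\mathcal P=\{X_1,\dots,X_t\}$ of $V(C)$, $$e_E(\mathcal P)\ \ge\ \sum_{q=1}^t f_C(X_q).$$ Moreover, for every strong component $C$ the function $f_C$ is intersecting supermodular: $f_C(X)+f_C(Y)\le f_C(X\cup Y)+f_C(X\cap Y)$ for all $X,Y\subseteq V(C)$ with $X\cap Y\ne\emptyset$. -/

import Mathlib

/-- A mixed graph on the vertex set `V`, with undirected edges `E` and directed arcs `A`.
Parallel edges and arcs are allowed, loops are not. -/
structure MixedGraph (V E A : Type*) where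
  /-- the two end-vertices of an undirected edge -/
  ends : E → Sym2 V
  /-- the tail of an arc -/
  tail : A → V
  /-- the head of an arc -/
  head : A → V
  edge_loopless : ∀ e, ¬ (ends e).IsDiag
  arc_loopless : ∀ a, tail a ≠ head a

/-- A bi-set on `V`: a pair of sets `inner ⊆ outer`. -/
structure BiSet (V : Type*) where
  outer : Set V
  inner : Set V
  inner_subset : inner ⊆ outer

namespace MixedGraph

universe u v w

variable {V : Type u} {E : Type v} {A : Type w} {S : Type*}

/-- One can step from `x` to `y` along the edge (in either direction) or arc (forwards) `l`. -/
def Step (F : MixedGraph V E A) : E ⊕ A → V → V → Prop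
  | Sum.inl e, x, y => F.ends e = s(x, y)
  | Sum.inr a, x, y => F.tail a = x ∧ F.head a = y

/-- The unordered pair of end-vertices of an edge or arc, orientation forgotten. -/
def link (F : MixedGraph V E A) : E ⊕ A → Sym2 V
  | Sum.inl e => F.ends e
  | Sum.inr a => s(F.tail a, F.head a)

/-- Mixed walks: edges may be used in both directions, arcs only forwards. -/
inductive Walk (F : MixedGraph V E A) : V → V → Type (max u v w)
  | nil (x : V) : Walk F x x
  | cons {x y z : V} (l : E ⊕ A) (h : F.Step l x y) (p : Walk F y z) : Walk F x z

namespace Walk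

variable {F : MixedGraph V E A}

/-- The sequence of vertices of a walk. -/
def support {x y : V} : F.Walk x y → List V
  | nil x => [x]
  | cons (x := x) _ _ p => x :: p.support

/-- The sequence of edges and arcs of a walk. -/
def labels {x y : V} : F.Walk x y → List (E ⊕ A)
  | nil _ => []
  | cons l _ p => l :: p.labels

/-- A mixed path is a mixed walk without repeated vertices. -/
def IsPath {x y : V} (p : F.Walk x y) : Prop := p.support.Nodup

end Walk

/-- There is a mixed path from `x` to `y`. -/
def Reachable (F : MixedGraph V E A) (x y : V) : Prop := ∃ p : F.Walk x y, p.IsPath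

/-- `W(X)`: the set `X` together with all vertices outside `X` from which `X` is reachable. -/
def W (F : MixedGraph V E A) (X : Set V) : Set V :=
  X ∪ {v | v ∉ X ∧ ∃ x ∈ X, F.Reachable v x}

/-- A subgraph: sets of vertices, edges and arcs, containing the ends of its edges and arcs. -/
structure Subgraph (F : MixedGraph V E A) where
  verts : Set V
  edges : Set E
  arcs : Set A
  ends_mem : ∀ e ∈ edges, ∀ x ∈ F.ends e, x ∈ verts
  tail_mem : ∀ a ∈ arcs, F.tail a ∈ verts
  head_mem : ∀ a ∈ arcs, F.head a ∈ verts

namespace Subgraph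

variable {F : MixedGraph V E A}

/-- Inclusion of subgraphs. -/
instance : LE F.Subgraph where
  le C D := C.verts ⊆ D.verts ∧ C.edges ⊆ D.edges ∧ C.arcs ⊆ D.arcs

/-- The edges and arcs of a subgraph. -/
def labels (T : F.Subgraph) : Set (E ⊕ A) := Sum.inl '' T.edges ∪ Sum.inr '' T.arcs

/-- The walk `p` is contained in the subgraph `T`. -/
def Contains (T : F.Subgraph) {x y : V} (p : F.Walk x y) : Prop :=
  (∀ z ∈ p.support, z ∈ T.verts) ∧ ∀ l ∈ p.labels, l ∈ T.labels

/-- There is a mixed path from `x` to `y` in the subgraph `T`. -/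
def Reachable (T : F.Subgraph) (x y : V) : Prop :=
  ∃ p : F.Walk x y, p.IsPath ∧ T.Contains p

/-- Any two vertices of the subgraph are reachable from each other in it. -/
def IsStronglyConnected (C : F.Subgraph) : Prop :=
  ∀ x ∈ C.verts, ∀ y ∈ C.verts, C.Reachable x y

/-- A strong component is a maximal strongly connected subgraph. -/
def IsStrongComponent (C : F.Subgraph) : Prop := Maximal IsStronglyConnected C

/-- The underlying undirected graph of `T`, with parallel edges merged. -/
def toSimpleGraph (T : F.Subgraph) : SimpleGraph T.verts :=
  SimpleGraph.fromRel fun x y => ∃ l ∈ T.labels, F.link l = s((x : V), (y : V))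

/-- The underlying undirected multigraph of `T` is a tree: it has no parallel edges (these form
cycles of length two), and as a simple graph it is connected and acyclic. -/
def IsTree (T : F.Subgraph) : Prop := Set.InjOn F.link T.labels ∧ T.toSimpleGraph.IsTree

/-- `T` is a mixed arborescence with root `r`. -/
def IsMixedArborescence (T : F.Subgraph) (r : V) : Prop :=
  T.IsTree ∧ ∀ x ∈ T.verts, ∃! p : F.Walk r x, p.IsPath ∧ T.Contains p

end Subgraph

/-- `e_E(P)` for a family `P` of disjoint vertex sets: the number of edges that connect two distinct
members of `P`, or a member of `P` and the complement of their union. -/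
noncomputable def edgeCount (F : MixedGraph V E A) {ι : Type*} (P : ι → Set V) : ℕ :=
  {e : E | ∃ x y, F.ends e = s(x, y) ∧
    ((∃ i j, i ≠ j ∧ x ∈ P i ∧ y ∈ P j) ∨ (∃ i, x ∈ P i ∧ y ∉ ⋃ j, P j))}.ncard

/-- `d⁻_A(X)` for a vertex set `X`: the number of arcs entering `X`. -/
noncomputable def inDegree (F : MixedGraph V E A) (X : Set V) : ℕ :=
  {a : A | F.tail a ∉ X ∧ F.head a ∈ X}.ncard

/-- `d⁻_A(X)` for a bi-set `X`: the number of arcs from outside the outer set to the inner set. -/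
noncomputable def inDegreeBi (F : MixedGraph V E A) (X : BiSet V) : ℕ :=
  {a : A | F.tail a ∉ X.outer ∧ F.head a ∈ X.inner}.ncard

/-- `r_M(S_X)`, the rank of the set `S_X = π⁻¹(X)` of matroid elements placed in `X`, as an
integer (the rank is finite if `S` is). -/
noncomputable def rankAt (M : Matroid S) (π : S → V) (X : Set V) : ℤ :=
  ((M.eRk (π ⁻¹' X)).toNat : ℤ)

/-- `π` is `M`-independent. -/
def IsMIndependent (M : Matroid S) (π : S → V) : Prop := ∀ x : V, M.Indep (π ⁻¹' {x})

/-- The family `T` is a maximal `M`-independent packing of mixed arborescences. -/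
def IsMaximalIndependentPacking (F : MixedGraph V E A) (M : Matroid S) (π : S → V)
    (T : S → F.Subgraph) : Prop :=
  (∀ s, (T s).IsMixedArborescence (π s)) ∧
  (∀ s s', s ≠ s' → Disjoint (T s).edges (T s').edges ∧ Disjoint (T s).arcs (T s').arcs) ∧
  ∀ x : V, M.Indep {s | x ∈ (T s).verts} ∧
    (({s | x ∈ (T s).verts}.ncard : ℕ) : ℤ) = rankAt M π (F.W {x})

/-- `P` is a subpartition of `U`: its members are nonempty, pairwise disjoint subsets of `U`. -/
def IsSubpartition {ι : Type*} (P : ι → Set V) (U : Set V) : Prop :=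
  (∀ i, (P i).Nonempty ∧ P i ⊆ U) ∧ ∀ i j, i ≠ j → Disjoint (P i) (P j)

/-- The integers over which the maximum defining `f_C(Z)` is taken, where `U = V(C)`. -/
def coverValues (F : MixedGraph V E A) (M : Matroid S) (π : S → V) (U Z : Set V) : Set ℤ :=
  {n | ∃ X Y : Set V, Z ⊆ X ∧ Y ⊆ F.W U \ U ∧ X \ Z = F.W Y ∧
    n = rankAt M π (F.W U) - rankAt M π X - (F.inDegree X : ℤ)}

/-- `f_C(Z)`, where `U = V(C)`: the maximum of `r_M(S_{W(U)}) - r_M(S_X) - d⁻_A(X)` over all `X ⊇ Z`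
with `X \ Z = W(Y)` for some `Y ⊆ W(U) \ U`. -/
noncomputable def coverFun (F : MixedGraph V E A) (M : Matroid S) (π : S → V) (U Z : Set V) : ℤ :=
  sSup (F.coverValues M π U Z)

/-- On a finite vertex set the supremum defining `f_C` is a maximum. -/
theorem coverFun_isGreatest [Finite V] (F : MixedGraph V E A) (M : Matroid S) (π : S → V)
    (U Z : Set V) : IsGreatest (F.coverValues M π U Z) (F.coverFun M π U Z) := by
  have hne : (F.coverValues M π U Z).Nonempty :=
    ⟨_, Z, ∅, subset_rfl, Set.empty_subset _, by simp [W], rfl⟩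
  have hfin : (F.coverValues M π U Z).Finite := by
    refine (Set.finite_range fun X : Set V =>
      rankAt M π (F.W U) - rankAt M π X - (F.inDegree X : ℤ)).subset ?_
    rintro n ⟨X, Y, -, -, -, rfl⟩
    exact ⟨X, rfl⟩
  exact ⟨hne.csSup_mem hfin, fun n hn => le_csSup hfin.bddAbove hn⟩

/-- `f` is intersecting supermodular on the nonempty subsets of `U`. -/
def IsIntersectingSupermodularOn (f : Set V → ℤ) (U : Set V) : Prop :=
  ∀ X Y : Set V, X ⊆ U → Y ⊆ U → (X ∩ Y).Nonempty → f X + f Y ≤ f (X ∪ Y) + f (X ∩ Y)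

end MixedGraph

/-!
The proof combines an orientation theorem with a packing theorem for digraphs.

*Necessity.* In a mixed arborescence every edge is traversed away from the root, in one direction
only, because mixed paths from the root are unique
(`Subgraph.IsMixedArborescence.not_uses_symm`). Given a packing and a bi-set `X` as in (ii), choose
a vertex of the inner set. It lies in `r_M(S_{W(V(C))})` of the arborescences, and at most
`r_M(S_{X_O})` of these have their root in the outer set, by independence. Each of the others uses
an arc entering the bi-set or an edge directed into the inner set, and an edge serves only one
member of the subpartition; this gives `IsMaximalIndependentPacking.sum_le`.

*The function `f_C`.* A set `W(Y)` has no entering edges or arcs, so a maximising set `X` for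
`f_C(Z)` is the outer set of a bi-set with inner set `Z` and the same in-degree; hence (ii) implies
(iii). Submodularity of rank and in-degree yields `coverFun_intersectingSupermodular`.

*Orientation.* By Frank's theorem (`exists_orientation`) the inequalities in (iii) allow the edges
of each strong component to be oriented such that the in-degree of every nonempty `Z ⊆ V(C)` is at
least `f_C(Z)`. Relative to a reference orientation, the sums over subpartitions of
`b(Z) = f_C(Z) - d⁻(Z)` can be uncrossed like a fully supermodular function
(`PartitionSum.uncross`), and edges are fixed or reversed one at a time: an edge for which neither
is possible gives two tight sets whose uncrossing contradicts strict submodularity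
(`exists_reversal`).

*Packing.* In the oriented graph all arborescences are grown simultaneously from their roots, where
`B v` is the set of roots that have reached `v`. The invariant is
`r_M(S_{W(x)}) - r_M(B_X) ≤ d⁻(X)`, where `d⁻` counts unused arcs and `X` ranges over the sets of
`IsCutSet`. At a first strong component that is not yet saturated, a minimal tight set `X` that is
not spanned by one of its vertices in the component contains an arc `uv` along which some root
`s ∈ B u` outside the span of `B v` can move; a tight set forbidding this would uncross with `X` to
a smaller one (`PartialPacking.exists_extension`). When no vertex is deficient, the sets `B v`
describe the packing. The grown subgraphs are mixed arborescences since they are connected and have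
one vertex more than edges and arcs (`Subgraph.isMixedArborescence_of_ncard`).
-/

namespace MixedGraph

variable {V E A S α : Type*} {F : MixedGraph V E A}

/-! ### Walks and reachability -/

theorem Step.link_eq {l : E ⊕ A} {x y : V} (h : F.Step l x y) : F.link l = s(x, y) := by
  rcases l with e | a
  · exact h
  · obtain ⟨rfl, rfl⟩ := h
    rfl

theorem Step.ne {l : E ⊕ A} {x y : V} (h : F.Step l x y) : x ≠ y := by
  rintro rfl
  rcases l with e | a
  · exact F.edge_loopless e (by rw [show F.ends e = s(x, x) from h]; simp)
  · exact F.arc_loopless a (h.1.trans h.2.symm)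

namespace Walk

theorem start_mem_support {x y : V} (p : F.Walk x y) : x ∈ p.support := by
  cases p <;> simp [support]

theorem end_mem_support {x y : V} (p : F.Walk x y) : y ∈ p.support := by
  induction p with
  | nil => simp [support]
  | cons l h p ih => simp [support, ih]

theorem support_eq_cons {x y : V} (p : F.Walk x y) : ∃ t, p.support = x :: t := by
  cases p <;> simp [support]

/-- Extension of a walk by a step at its end. -/
def concat {x y z : V} : F.Walk x y → (l : E ⊕ A) → F.Step l y z → F.Walk x z
  | nil _, l, h => cons l h (nil _)
  | cons l' h' p, l, h => cons l' h' (p.concat l h)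

theorem support_concat {x y z : V} (p : F.Walk x y) (l : E ⊕ A) (h : F.Step l y z) :
    (p.concat l h).support = p.support ++ [z] := by
  induction p with
  | nil => simp [support, concat]
  | cons l' h' p ih => simp [support, concat, ih]

theorem labels_concat {x y z : V} (p : F.Walk x y) (l : E ⊕ A) (h : F.Step l y z) :
    (p.concat l h).labels = p.labels ++ [l] := by
  induction p with
  | nil => simp [labels, concat]
  | cons l' h' p ih => simp [labels, concat, ih]

theorem IsPath.concat {x y z : V} {p : F.Walk x y} (hp : p.IsPath) (l : E ⊕ A)
    (h : F.Step l y z) (hz : z ∉ p.support) : (p.concat l h).IsPath := by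
  unfold IsPath at *
  rw [support_concat, List.nodup_append]
  refine ⟨hp, by simp, ?_⟩
  rintro a ha b hb rfl
  rw [List.mem_singleton] at hb
  exact hz (hb ▸ ha)

theorem IsPath.exists_suffix {x y a : V} {p : F.Walk x y} (hp : p.IsPath) (ha : a ∈ p.support) :
    ∃ q : F.Walk a y, q.IsPath ∧ ∀ l ∈ q.labels, l ∈ p.labels := by
  induction p with
  | nil x =>
    obtain rfl : a = x := by simpa [support] using ha
    exact ⟨nil a, hp, fun l hl => hl⟩
  | @cons x b y l h p ih =>
    by_cases hax : a = x
    · subst hax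
      exact ⟨cons l h p, hp, fun l hl => hl⟩
    · have ha' : a ∈ p.support := by
        simpa [support, hax] using ha
      obtain ⟨q, hq, hql⟩ := ih (List.nodup_cons.1 hp).2 ha'
      exact ⟨q, hq, fun l' hl' => List.mem_cons_of_mem _ (hql l' hl')⟩

/-- A walk within a subgraph whose edges and arcs have distinct links is determined by its
vertices. -/
theorem eq_of_support_eq {L : Set (E ⊕ A)} (hL : Set.InjOn F.link L) {x y : V}
    (p q : F.Walk x y) (hp : ∀ l ∈ p.labels, l ∈ L) (hq : ∀ l ∈ q.labels, l ∈ L)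
    (h : p.support = q.support) : p = q := by
  induction p with
  | nil x =>
    cases q with
    | nil => rfl
    | cons l' h' q =>
      obtain ⟨t, ht⟩ := q.support_eq_cons
      simp [support, ht] at h
  | cons l hl p ih =>
    cases q with
    | nil =>
      obtain ⟨t, ht⟩ := p.support_eq_cons
      simp [support, ht] at h
    | cons l' hl' q =>
      have hs : p.support = q.support := by simpa [support] using h
      obtain ⟨t, ht⟩ := p.support_eq_cons
      obtain ⟨t', ht'⟩ := q.support_eq_cons
      rw [ht, ht'] at hs
      obtain ⟨rfl, -⟩ := List.cons.inj hs
      obtain rfl : l = l' := hL (hp l (by simp [labels])) (hq l' (by simp [labels]))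
        (hl.link_eq.trans hl'.link_eq.symm)
      rw [ih q (fun l h => hp l (by simp [labels, h])) (fun l h => hq l (by simp [labels, h]))
        (ht.trans (hs.trans ht'.symm))]

end Walk

theorem exists_path_of_reflTransGen {L : Set (E ⊕ A)} {x y : V}
    (h : Relation.ReflTransGen (fun x y => ∃ l ∈ L, F.Step l x y) x y) :
    ∃ p : F.Walk x y, p.IsPath ∧ ∀ l ∈ p.labels, l ∈ L := by
  induction h using Relation.ReflTransGen.head_induction_on with
  | refl => exact ⟨.nil y, by simp [Walk.IsPath, Walk.support], by simp [Walk.labels]⟩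
  | @head a b hab _ ih =>
    obtain ⟨p, hp, hpl⟩ := ih
    obtain ⟨l, hl, hs⟩ := hab
    by_cases ha : a ∈ p.support
    · obtain ⟨q, hq, hql⟩ := hp.exists_suffix ha
      exact ⟨q, hq, fun l hl => hpl l (hql l hl)⟩
    · refine ⟨.cons l hs p, List.nodup_cons.2 ⟨ha, hp⟩, ?_⟩
      intro l' hl'
      rcases List.mem_cons.1 hl' with rfl | h
      exacts [hl, hpl _ h]

theorem Walk.reflTransGen {L : Set (E ⊕ A)} {x y : V} (p : F.Walk x y)
    (hp : ∀ l ∈ p.labels, l ∈ L) :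
    Relation.ReflTransGen (fun x y => ∃ l ∈ L, F.Step l x y) x y := by
  induction p with
  | nil => exact .refl
  | cons l h p ih =>
    exact .head ⟨l, hp l (by simp [labels]), h⟩ (ih fun l hl => hp l (by simp [labels, hl]))

theorem reachable_iff {x y : V} :
    F.Reachable x y ↔ Relation.ReflTransGen (fun x y => ∃ l, F.Step l x y) x y := by
  have : (fun x y => ∃ l, F.Step l x y) =
      fun x y => ∃ l ∈ (Set.univ : Set (E ⊕ A)), F.Step l x y := by
    simp
  rw [this]
  constructor
  · rintro ⟨p, -⟩
    exact p.reflTransGen (by simp)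
  · intro h
    obtain ⟨p, hp, -⟩ := exists_path_of_reflTransGen h
    exact ⟨p, hp⟩

theorem Reachable.refl (x : V) : F.Reachable x x := reachable_iff.2 .refl

theorem Reachable.trans {x y z : V} (h : F.Reachable x y) (h' : F.Reachable y z) :
    F.Reachable x z :=
  reachable_iff.2 ((reachable_iff.1 h).trans (reachable_iff.1 h'))

theorem Step.reachable {l : E ⊕ A} {x y : V} (h : F.Step l x y) : F.Reachable x y :=
  reachable_iff.2 (.single ⟨l, h⟩)

theorem Walk.reachable {x y : V} (p : F.Walk x y) : F.Reachable x y :=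
  reachable_iff.2 (by simpa using p.reflTransGen (L := Set.univ) (by simp))

theorem mem_W {X : Set V} {v : V} : v ∈ F.W X ↔ ∃ x ∈ X, F.Reachable v x := by
  constructor
  · rintro (h | ⟨-, h⟩)
    exacts [⟨v, h, .refl v⟩, h]
  · rintro ⟨x, hx, h⟩
    by_cases hv : v ∈ X
    exacts [Or.inl hv, Or.inr ⟨hv, x, hx, h⟩]

theorem mem_W_singleton {x v : V} : v ∈ F.W {x} ↔ F.Reachable v x := by simp [mem_W]

theorem subset_W (X : Set V) : X ⊆ F.W X := fun _ h => Or.inl h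

theorem mem_W_of_reachable {X : Set V} {u v : V} (h : F.Reachable u v) (hv : v ∈ F.W X) :
    u ∈ F.W X := by
  obtain ⟨x, hx, hvx⟩ := mem_W.1 hv
  exact mem_W.2 ⟨x, hx, h.trans hvx⟩

theorem W_eq_self {X : Set V} (h : ∀ v ∈ X, ∀ u, F.Reachable u v → u ∈ X) : F.W X = X := by
  refine (Set.Subset.antisymm (subset_W X) fun v hv => ?_).symm
  obtain ⟨x, hx, hvx⟩ := mem_W.1 hv
  exact h x hx v hvx

theorem W_union (X Y : Set V) : F.W (X ∪ Y) = F.W X ∪ F.W Y := by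
  ext v
  simp only [mem_W, Set.mem_union]
  constructor
  · rintro ⟨x, hx | hx, h⟩
    exacts [.inl ⟨x, hx, h⟩, .inr ⟨x, hx, h⟩]
  · rintro (⟨x, hx, h⟩ | ⟨x, hx, h⟩)
    exacts [⟨x, .inl hx, h⟩, ⟨x, .inr hx, h⟩]

namespace Subgraph

theorem mem_verts_of_step {T : F.Subgraph} {l : E ⊕ A} (hl : l ∈ T.labels) {x y : V}
    (h : F.Step l x y) : x ∈ T.verts ∧ y ∈ T.verts := by
  rcases l with e | a
  · have he : e ∈ T.edges := by simpa [labels] using hl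
    have h' : F.ends e = s(x, y) := h
    exact ⟨T.ends_mem e he x (by simp [h']), T.ends_mem e he y (by simp [h'])⟩
  · have ha : a ∈ T.arcs := by simpa [labels] using hl
    exact ⟨h.1 ▸ T.tail_mem a ha, h.2 ▸ T.head_mem a ha⟩

theorem contains_of_labels {T : F.Subgraph} {x y : V} (p : F.Walk x y) (hx : x ∈ T.verts)
    (hp : ∀ l ∈ p.labels, l ∈ T.labels) : T.Contains p := by
  refine ⟨?_, hp⟩
  induction p with
  | nil => simpa [Walk.support] using hx
  | cons l h p ih =>
    intro z hz
    rcases List.mem_cons.1 hz with rfl | hz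
    · exact hx
    · exact ih (mem_verts_of_step (hp l (by simp [Walk.labels])) h).2
        (fun l hl => hp l (by simp [Walk.labels, hl])) z hz

theorem reachable_of_reflTransGen {T : F.Subgraph} {x y : V} (hx : x ∈ T.verts)
    (h : Relation.ReflTransGen (fun x y => ∃ l ∈ T.labels, F.Step l x y) x y) :
    T.Reachable x y := by
  obtain ⟨p, hp, hpl⟩ := exists_path_of_reflTransGen h
  exact ⟨p, hp, contains_of_labels p hx hpl⟩

end Subgraph

/-! ### Strong components -/

/-- The set of vertices that are reachable from `x` and from which `x` is reachable. -/
def strongClass (F : MixedGraph V E A) (x : V) : Set V := {y | F.Reachable x y ∧ F.Reachable y x}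

theorem mem_strongClass_self (x : V) : x ∈ F.strongClass x := ⟨.refl x, .refl x⟩

theorem strongClass_eq {x y : V} (h : y ∈ F.strongClass x) : F.strongClass y = F.strongClass x := by
  ext z
  exact ⟨fun hz => ⟨h.1.trans hz.1, hz.2.trans h.2⟩, fun hz => ⟨h.2.trans hz.1, hz.2.trans h.1⟩⟩

/-- The subgraph induced by the vertices that are mutually reachable with `x`. -/
def component (F : MixedGraph V E A) (x : V) : F.Subgraph where
  verts := F.strongClass x
  edges := {e | ∀ z ∈ F.ends e, z ∈ F.strongClass x}
  arcs := {a | F.tail a ∈ F.strongClass x ∧ F.head a ∈ F.strongClass x}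
  ends_mem := fun _ h => h
  tail_mem := fun _ h => h.1
  head_mem := fun _ h => h.2

theorem step_mem_component {x y z : V} {l : E ⊕ A} (h : F.Step l y z)
    (hy : y ∈ F.strongClass x) (hz : z ∈ F.strongClass x) : l ∈ (F.component x).labels := by
  rcases l with e | a
  · left
    refine ⟨e, ?_, rfl⟩
    intro w hw
    rw [show F.ends e = s(y, z) from h, Sym2.mem_iff] at hw
    rcases hw with rfl | rfl <;> assumption
  · right
    refine ⟨a, ?_, rfl⟩
    exact ⟨h.1 ▸ hy, h.2 ▸ hz⟩

theorem component_isStronglyConnected (x : V) : (F.component x).IsStronglyConnected := by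
  intro y hy z hz
  refine Subgraph.reachable_of_reflTransGen hy ?_
  have hyz : F.Reachable y z := hy.2.trans hz.1
  have hzx : F.Reachable z x := hz.2
  clear hz
  rw [reachable_iff] at hyz
  induction hyz with
  | refl => exact .refl
  | @tail b c hab hbc ih =>
    obtain ⟨l, hl⟩ := hbc
    have hbx : F.Reachable b x := hl.reachable.trans hzx
    have hb : b ∈ F.strongClass x := ⟨hy.1.trans (reachable_iff.2 hab), hbx⟩
    have hc : c ∈ F.strongClass x := ⟨hb.1.trans hl.reachable, hzx⟩
    exact (ih hbx).tail ⟨l, step_mem_component hl hb hc, hl⟩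

theorem Subgraph.IsStronglyConnected.le_component {C : F.Subgraph} (h : C.IsStronglyConnected)
    {x : V} (hx : x ∈ C.verts) : C ≤ F.component x := by
  have key : ∀ y ∈ C.verts, y ∈ F.strongClass x := fun y hy => by
    obtain ⟨p, -, -⟩ := h x hx y hy
    obtain ⟨q, -, -⟩ := h y hy x hx
    exact ⟨p.reachable, q.reachable⟩
  exact ⟨key, fun e he z hz => key z (C.ends_mem e he z hz),
    fun a ha => ⟨key _ (C.tail_mem a ha), key _ (C.head_mem a ha)⟩⟩

theorem component_isStrongComponent (x : V) : (F.component x).IsStrongComponent :=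
  ⟨component_isStronglyConnected x, fun _ hD hle =>
    hD.le_component (hle.1 (mem_strongClass_self x))⟩

theorem Subgraph.IsStrongComponent.verts_eq {C : F.Subgraph} (h : C.IsStrongComponent) {x : V}
    (hx : x ∈ C.verts) : C.verts = F.strongClass x :=
  Set.Subset.antisymm (h.1.le_component hx).1
    (h.2 (component_isStronglyConnected x) (h.1.le_component hx)).1

theorem W_strongClass (x : V) : F.W (F.strongClass x) = F.W {x} := by
  ext v
  rw [mem_W, mem_W_singleton]
  exact ⟨fun ⟨y, hy, h⟩ => h.trans hy.2, fun h => ⟨x, mem_strongClass_self x, h⟩⟩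

/-- Vertices from which a vertex set outside a strong component, but preceding it, is reachable
are again outside the strong component. -/
theorem disjoint_strongClass_W {x : V} {Y : Set V}
    (hY : Y ⊆ F.W (F.strongClass x) \ F.strongClass x) : Disjoint (F.strongClass x) (F.W Y) := by
  rw [Set.disjoint_left]
  intro v hv hvY
  obtain ⟨y, hy, hvy⟩ := mem_W.1 hvY
  obtain ⟨hyW, hyx⟩ := hY hy
  rw [W_strongClass, mem_W_singleton] at hyW
  exact hyx ⟨hv.1.trans hvy, hyW⟩

theorem W_subset_of_subset {x : V} {Y : Set V}
    (hY : Y ⊆ F.W (F.strongClass x) \ F.strongClass x) :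
    F.W Y ⊆ F.W (F.strongClass x) \ F.strongClass x := by
  intro v hv
  refine ⟨?_, fun h => Set.disjoint_left.1 (disjoint_strongClass_W hY) h hv⟩
  obtain ⟨y, hy, hvy⟩ := mem_W.1 hv
  exact mem_W_of_reachable hvy (hY hy).1

/-! ### Ranks as integers -/

/-- The rank of a set in a matroid of finite rank, as an integer. -/
noncomputable def rk (M : Matroid S) (X : Set S) : ℤ := ((M.eRk X).toNat : ℤ)

section Rank

variable (M : Matroid S)

theorem coe_toNat_eRk [Finite S] (X : Set S) : ((M.eRk X).toNat : ℕ∞) = M.eRk X :=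
  ENat.natCast_toNat (Matroid.eRk_ne_top_iff.2 (M.isRkFinite_of_finite X.toFinite))

theorem rk_le_rk_iff [Finite S] {X Y : Set S} : rk M X ≤ rk M Y ↔ M.eRk X ≤ M.eRk Y := by
  rw [← coe_toNat_eRk M X, ← coe_toNat_eRk M Y]
  simp [rk]

theorem rk_mono [Finite S] {X Y : Set S} (h : X ⊆ Y) : rk M X ≤ rk M Y :=
  (rk_le_rk_iff M).2 (M.eRk_mono h)

theorem rk_inter_add_rk_union_le [Finite S] (X Y : Set S) :
    rk M (X ∩ Y) + rk M (X ∪ Y) ≤ rk M X + rk M Y := by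
  have := M.eRk_inter_add_eRk_union_le X Y
  rw [← coe_toNat_eRk M X, ← coe_toNat_eRk M Y, ← coe_toNat_eRk M (X ∩ Y),
    ← coe_toNat_eRk M (X ∪ Y)] at this
  unfold rk
  exact_mod_cast this

theorem rk_closure (X : Set S) : rk M (M.closure X) = rk M X := by
  rw [rk, Matroid.eRk_closure_eq, rk]

theorem rk_le_of_subset_closure [Finite S] {X Y : Set S} (h : X ⊆ M.closure Y) : rk M X ≤ rk M Y :=
  (rk_mono M h).trans (rk_closure M Y).le

theorem rk_eq_ncard {I : Set S} (hI : M.Indep I) : rk M I = (I.ncard : ℤ) := by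
  rw [rk, hI.eRk_eq_encard, Set.ncard_def]

theorem subset_closure_of_rk_le [Finite S] (hM : M.E = Set.univ) {X Y : Set S} (h : X ⊆ Y)
    (hr : rk M Y ≤ rk M X) : Y ⊆ M.closure X := by
  rw [(M.isRkFinite_of_finite X.toFinite).closure_eq_closure_of_subset_of_eRk_ge_eRk h
    ((rk_le_rk_iff M).1 hr)]
  exact M.subset_closure Y (by simp [hM])

theorem rk_insert [Finite S] (hM : M.E = Set.univ) {e : S} {X : Set S} (he : e ∉ M.closure X) :
    rk M (insert e X) = rk M X + 1 := by
  have := M.eRk_insert_eq_add_one (e := e) (X := X) ⟨by simp [hM], he⟩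
  rw [← coe_toNat_eRk M X, ← coe_toNat_eRk M (insert e X)] at this
  unfold rk
  exact_mod_cast this

end Rank

/-! ### Entering arcs -/

/-- The members of `R` that enter the vertex set `X`, where `l` has tail `tl l` and head `hd l`. -/
def entering (R : Set α) (tl hd : α → V) (X : Set V) : Set α := {l ∈ R | tl l ∉ X ∧ hd l ∈ X}

theorem ncard_entering_submodular [Finite α] (R : Set α) (tl hd : α → V) (X Y : Set V) :
    (entering R tl hd (X ∪ Y)).ncard + (entering R tl hd (X ∩ Y)).ncard ≤
      (entering R tl hd X).ncard + (entering R tl hd Y).ncard := by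
  rw [← Set.ncard_union_add_ncard_inter (entering R tl hd (X ∪ Y)),
    ← Set.ncard_union_add_ncard_inter (entering R tl hd X)]
  refine add_le_add (Set.ncard_le_ncard ?_) (Set.ncard_le_ncard ?_)
  · intro l
    simp only [entering, Set.mem_union, Set.mem_inter_iff, Set.mem_ofPred_eq]
    tauto
  · intro l
    simp only [entering, Set.mem_union, Set.mem_inter_iff, Set.mem_ofPred_eq]
    tauto

theorem inDegree_eq (X : Set V) : F.inDegree X = (entering Set.univ F.tail F.head X).ncard := by
  simp [inDegree, entering]

theorem inDegree_submodular [Finite A] (X Y : Set V) :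
    F.inDegree (X ∪ Y) + F.inDegree (X ∩ Y) ≤ F.inDegree X + F.inDegree Y := by
  simp only [inDegree_eq]
  exact ncard_entering_submodular _ _ _ _ _

theorem rankAt_submodular [Finite S] (M : Matroid S) (π : S → V) (X Y : Set V) :
    rankAt M π (X ∪ Y) + rankAt M π (X ∩ Y) ≤ rankAt M π X + rankAt M π Y := by
  have := rk_inter_add_rk_union_le M (π ⁻¹' X) (π ⁻¹' Y)
  unfold rankAt
  unfold rk at this
  rw [Set.preimage_union, Set.preimage_inter]
  linarith

/-! ### The covering function of a strong component -/

theorem coverFun_intersectingSupermodular [Finite V] [Finite A] [Finite S] (M : Matroid S)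
    (π : S → V) {C : F.Subgraph} (hC : C.IsStrongComponent) :
    IsIntersectingSupermodularOn (F.coverFun M π C.verts) C.verts := by
  intro Z₁ Z₂ h₁ h₂ hne
  obtain ⟨x, hx⟩ := hne
  have hU := hC.verts_eq (h₁ hx.1)
  rw [hU] at h₁ h₂ ⊢
  obtain ⟨X₁, Y₁, hZ₁, hY₁, hXY₁, he₁⟩ :=
    (coverFun_isGreatest F M π (F.strongClass x) Z₁).1
  obtain ⟨X₂, Y₂, hZ₂, hY₂, hXY₂, he₂⟩ :=
    (coverFun_isGreatest F M π (F.strongClass x) Z₂).1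
  have hd₁ := Set.disjoint_left.1 (disjoint_strongClass_W hY₁)
  have hd₂ := Set.disjoint_left.1 (disjoint_strongClass_W hY₂)
  have hX₁ : X₁ = Z₁ ∪ F.W Y₁ := by rw [← hXY₁, Set.union_sdiff_cancel hZ₁]
  have hX₂ : X₂ = Z₂ ∪ F.W Y₂ := by rw [← hXY₂, Set.union_sdiff_cancel hZ₂]
  have hunion := (coverFun_isGreatest F M π (F.strongClass x) (Z₁ ∪ Z₂)).2
    ⟨X₁ ∪ X₂, Y₁ ∪ Y₂, Set.union_subset_union hZ₁ hZ₂, Set.union_subset hY₁ hY₂, by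
      rw [W_union, hX₁, hX₂]
      ext v
      have := @hd₁ v
      have := @hd₂ v
      have := @h₁ v
      have := @h₂ v
      simp only [Set.mem_sdiff, Set.mem_union]
      tauto, rfl⟩
  have hW : F.W (F.W Y₁ ∩ F.W Y₂) = F.W Y₁ ∩ F.W Y₂ := W_eq_self fun v hv u huv =>
    ⟨mem_W_of_reachable huv hv.1, mem_W_of_reachable huv hv.2⟩
  have hinter := (coverFun_isGreatest F M π (F.strongClass x) (Z₁ ∩ Z₂)).2
    ⟨X₁ ∩ X₂, F.W Y₁ ∩ F.W Y₂, Set.inter_subset_inter hZ₁ hZ₂,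
      fun v hv => W_subset_of_subset hY₁ hv.1, by
      rw [hW, hX₁, hX₂]
      ext v
      have := @hd₁ v
      have := @hd₂ v
      have := @h₁ v
      have := @h₂ v
      simp only [Set.mem_sdiff, Set.mem_union, Set.mem_inter_iff]
      tauto, rfl⟩
  have h3 := rankAt_submodular M π X₁ X₂
  have h4 := F.inDegree_submodular X₁ X₂
  zify at h4
  linarith

/-- An arc entering a bi-set `X` whose difference `outer \ inner` has no entering arcs is the same
as an arc entering its outer set. -/
theorem inDegree_outer {X : BiSet V} {Y : Set V} (h : X.outer \ X.inner = F.W Y) :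
    F.inDegree X.outer = F.inDegreeBi X := by
  unfold inDegree inDegreeBi
  congr 1
  ext a
  refine and_congr_right fun ht => ⟨fun hh => ?_, fun hh => X.inner_subset hh⟩
  by_contra hi
  have h1 : F.head a ∈ F.W Y := h ▸ ⟨hh, hi⟩
  have h2 : F.tail a ∈ F.W Y :=
    mem_W_of_reachable (Step.reachable (l := Sum.inr a) ⟨rfl, rfl⟩) h1
  rw [← h] at h2
  exact ht h2.1

/-! ### The orientation of a mixed arborescence -/

namespace Subgraph

theorem Contains.concat {T : F.Subgraph} {x y z : V} {p : F.Walk x y} (hp : T.Contains p)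
    {l : E ⊕ A} (hl : l ∈ T.labels) (h : F.Step l y z) : T.Contains (p.concat l h) := by
  constructor
  · intro w hw
    rw [Walk.support_concat, List.mem_append, List.mem_singleton] at hw
    rcases hw with hw | rfl
    exacts [hp.1 w hw, (mem_verts_of_step hl h).2]
  · intro w hw
    rw [Walk.labels_concat, List.mem_append, List.mem_singleton] at hw
    rcases hw with hw | rfl
    exacts [hp.2 w hw, hl]

/-- A mixed path of `T` that starts in `r` ends with a step along `l` from `x` to `y`. -/
def Uses (T : F.Subgraph) (r : V) (l : E ⊕ A) (x y : V) : Prop :=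
  l ∈ T.labels ∧ F.Step l x y ∧ ∃ p : F.Walk r x, p.IsPath ∧ T.Contains p ∧ y ∉ p.support

/-- No edge of a mixed arborescence is traversed in both directions by paths from the root. -/
theorem IsMixedArborescence.not_uses_symm {T : F.Subgraph} {r : V} (hT : T.IsMixedArborescence r)
    {l l' : E ⊕ A} {x y : V} (h : T.Uses r l x y) (h' : T.Uses r l' y x) : False := by
  obtain ⟨hl, hs, p, hp, hpT, hyp⟩ := h
  obtain ⟨hl', hs', q, hq, hqT, hxq⟩ := h'
  have := (hT.2 y (mem_verts_of_step hl hs).2).unique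
    ⟨hp.concat l hs hyp, hpT.concat hl hs⟩ ⟨hq, hqT⟩
  apply hxq
  rw [← this, Walk.support_concat]
  exact List.mem_append_left _ p.end_mem_support

theorem exists_uses_of_walk {T : F.Subgraph} {r : V} {I : Set V} {a z : V} (q : F.Walk r a)
    (p : F.Walk a z) (hq : q.IsPath) (hqT : T.Contains q) (hp : p.IsPath) (hpT : T.Contains p)
    (hdisj : ∀ w ∈ p.support, w ∈ q.support → w = a) (ha : a ∉ I) (hz : z ∈ I) :
    ∃ l x y, T.Uses r l x y ∧ x ∉ I ∧ y ∈ I := by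
  induction p with
  | nil => exact absurd hz ha
  | @cons a b z l h p ih =>
    have hp' := List.nodup_cons.1 hp
    have hl : l ∈ T.labels := hpT.2 l (by simp [Walk.labels])
    have hbq : b ∉ q.support := fun hb => h.ne
      (hdisj b (List.mem_cons_of_mem _ p.start_mem_support) hb).symm
    by_cases hb : b ∈ I
    · exact ⟨l, a, b, ⟨hl, h, q, hq, hqT, hbq⟩, ha, hb⟩
    · refine ih (q.concat l h) (hq.concat l h hbq) (hqT.concat hl h) hp'.2
        ⟨fun w hw => hpT.1 w (List.mem_cons_of_mem _ hw),
          fun w hw => hpT.2 w (List.mem_cons_of_mem _ hw)⟩ ?_ hb hz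
      intro w hw hwq
      rw [Walk.support_concat, List.mem_append, List.mem_singleton] at hwq
      rcases hwq with hwq | rfl
      · obtain rfl := hdisj w (List.mem_cons_of_mem _ hw) hwq
        exact absurd hw hp'.1
      · rfl

/-- A mixed arborescence that reaches a set of vertices not containing its root uses an edge or an
arc towards that set. -/
theorem IsMixedArborescence.exists_uses {T : F.Subgraph} {r : V} (hT : T.IsMixedArborescence r)
    {I : Set V} {z : V} (hr : r ∉ I) (hz : z ∈ I) (hzT : z ∈ T.verts) :
    ∃ l x y, T.Uses r l x y ∧ x ∉ I ∧ y ∈ I := by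
  obtain ⟨p, ⟨hp, hpT⟩, -⟩ := hT.2 z hzT
  refine exists_uses_of_walk (.nil r) p ?_ ⟨?_, ?_⟩ hp hpT ?_ hr hz
  · simp [Walk.IsPath, Walk.support]
  · intro w hw
    obtain rfl : w = r := by simpa [Walk.support] using hw
    exact hpT.1 _ p.start_mem_support
  · simp [Walk.labels]
  · intro w _ hw
    simpa [Walk.support] using hw

theorem IsMixedArborescence.root_mem {T : F.Subgraph} {r : V} (hT : T.IsMixedArborescence r) :
    r ∈ T.verts := by
  obtain ⟨⟨x, hx⟩⟩ := hT.1.2.connected.nonempty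
  obtain ⟨p, ⟨-, hp⟩, -⟩ := hT.2 x hx
  exact hp.1 _ p.start_mem_support

end Subgraph

/-! ### Necessity of the cut condition -/

section Necessity

variable {M : Matroid S} {π : S → V}
  {T : S → F.Subgraph}

/-- The edges that some member of the packing uses towards the vertex set `I`. -/
def edgesUsedInto (T : S → F.Subgraph) (π : S → V) (I : Set V) : Set E :=
  {e | ∃ s x y, (T s).Uses (π s) (Sum.inl e) x y ∧ x ∉ I ∧ y ∈ I}

theorem IsMaximalIndependentPacking.eq_of_mem_labels (h : F.IsMaximalIndependentPacking M π T)
    {s s' : S} {l : E ⊕ A} (hl : l ∈ (T s).labels) (hl' : l ∈ (T s').labels) : s = s' := by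
  by_contra hne
  rcases l with e | a
  · exact Set.disjoint_left.1 (h.2.1 s s' hne).1 (by simpa [Subgraph.labels] using hl)
      (by simpa [Subgraph.labels] using hl')
  · exact Set.disjoint_left.1 (h.2.1 s s' hne).2 (by simpa [Subgraph.labels] using hl)
      (by simpa [Subgraph.labels] using hl')

theorem IsMaximalIndependentPacking.disjoint_edgesUsedInto
    (h : F.IsMaximalIndependentPacking M π T) {I J : Set V} (hIJ : Disjoint I J) :
    Disjoint (edgesUsedInto T π I) (edgesUsedInto T π J) := by
  rw [Set.disjoint_left]
  rintro e ⟨s, x, y, hu, -, hy⟩ ⟨s', x', y', hu', -, hy'⟩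
  obtain rfl := h.eq_of_mem_labels hu.1 hu'.1
  have hxy : s(x, y) = s(x', y') := hu.2.1.link_eq.symm.trans hu'.2.1.link_eq
  rcases Sym2.eq_iff.1 hxy with ⟨rfl, rfl⟩ | ⟨rfl, rfl⟩
  · exact Set.disjoint_left.1 hIJ hy hy'
  · exact (h.1 s).not_uses_symm hu hu'

/-- The members of the packing that reach `inner` from a root outside `outer` use distinct arcs or
edges entering the bi-set. -/
theorem IsMaximalIndependentPacking.le_inDegreeBi_add [Finite E] [Finite A] [Finite S]
    (h : F.IsMaximalIndependentPacking M π T) (X : BiSet V) {Y : Set V}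
    (hY : X.outer \ X.inner = F.W Y) {x : V} (hx : x ∈ X.inner) :
    rankAt M π (F.W {x}) - rankAt M π X.outer ≤
      (edgesUsedInto T π X.inner).ncard + (F.inDegreeBi X : ℤ) := by
  set N : Set S := {s | x ∈ (T s).verts} with hN
  obtain ⟨hind, hcard⟩ := h.2.2 x
  have h1 : ((N ∩ π ⁻¹' X.outer).ncard : ℤ) ≤ rankAt M π X.outer := by
    rw [← rk_eq_ncard M (hind.subset Set.inter_subset_left)]
    exact rk_mono M Set.inter_subset_right
  have h2 : (N ∩ π ⁻¹' X.outer).ncard + (N \ π ⁻¹' X.outer).ncard = N.ncard :=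
    Set.ncard_inter_add_ncard_sdiff_eq_ncard _ _
  have h3 : ∀ s ∈ N \ π ⁻¹' X.outer, ∃ l ∈ (T s).labels,
      l ∈ Sum.inl '' edgesUsedInto T π X.inner ∪
        Sum.inr '' {a : A | F.tail a ∉ X.outer ∧ F.head a ∈ X.inner} := by
    rintro s ⟨hsN, hso⟩
    obtain ⟨l, u, v, hu, hui, hvi⟩ :=
      (h.1 s).exists_uses (fun hr => hso (X.inner_subset hr)) hx hsN
    refine ⟨l, hu.1, ?_⟩
    rcases l with e | a
    · exact .inl ⟨e, ⟨s, u, v, hu, hui, hvi⟩, rfl⟩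
    · refine .inr ⟨a, ⟨fun hto => ?_, ?_⟩, rfl⟩
      -- otherwise the root would lie in `outer`, since no walk enters `outer \ inner`
      · obtain ⟨-, hs, p, -⟩ := hu
        rw [hs.1] at hto
        have : π s ∈ X.outer \ X.inner := by
          rw [hY]
          exact mem_W_of_reachable p.reachable (hY ▸ ⟨hto, hui⟩)
        exact hso this.1
      · rw [hu.2.1.2]
        exact hvi
  have h4 : (N \ π ⁻¹' X.outer).ncard ≤ (Sum.inl '' edgesUsedInto T π X.inner ∪
      Sum.inr '' {a : A | F.tail a ∉ X.outer ∧ F.head a ∈ X.inner} : Set (E ⊕ A)).ncard := by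
    rcases (N \ π ⁻¹' X.outer).eq_empty_or_nonempty with h0 | ⟨s₀, hs₀⟩
    · simp [h0]
    · have : Nonempty (E ⊕ A) := ⟨(h3 s₀ hs₀).choose⟩
      choose! f hf hf' using h3
      exact Set.ncard_le_ncard_of_injOn f hf' fun s hs s' hs' hss' =>
        h.eq_of_mem_labels (hf s hs) (hss' ▸ hf s' hs')
  have h5 := h4.trans (Set.ncard_union_le _ _)
  rw [Set.ncard_image_of_injective _ Sum.inl_injective,
    Set.ncard_image_of_injective _ Sum.inr_injective] at h5
  change _ ≤ _ + F.inDegreeBi X at h5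
  zify at h2 h5
  linarith

theorem IsMaximalIndependentPacking.isMIndependent (h : F.IsMaximalIndependentPacking M π T) :
    IsMIndependent M π := fun x => (h.2.2 x).1.subset fun s hs => by
  obtain rfl : π s = x := hs
  exact (h.1 s).root_mem

theorem IsMaximalIndependentPacking.sum_le [Finite E] [Finite A] [Finite S]
    (h : F.IsMaximalIndependentPacking M π T)
    {C : F.Subgraph} (hC : C.IsStrongComponent) {t : ℕ} (X : Fin t → BiSet V)
    (hX : IsSubpartition (fun q => (X q).inner) C.verts)
    (hY : ∀ q, ∃ Y : Set V, Y ⊆ F.W C.verts \ C.verts ∧ (X q).outer \ (X q).inner = F.W Y) :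
    ∑ q, (rankAt M π (F.W C.verts) - rankAt M π (X q).outer) ≤
      (F.edgeCount (fun q => (X q).inner) : ℤ) + ∑ q, (F.inDegreeBi (X q) : ℤ) := by
  have h1 : ∀ q, rankAt M π (F.W C.verts) - rankAt M π (X q).outer ≤
      (edgesUsedInto T π (X q).inner).ncard + (F.inDegreeBi (X q) : ℤ) := by
    intro q
    obtain ⟨x, hx⟩ := (hX.1 q).1
    obtain ⟨Y, -, hYq⟩ := hY q
    rw [hC.verts_eq ((hX.1 q).2 hx), W_strongClass]
    exact h.le_inDegreeBi_add (X q) hYq hx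
  have h2 : ∑ q, (edgesUsedInto T π (X q).inner).ncard ≤ F.edgeCount (fun q => (X q).inner) := by
    rw [← finsum_eq_sum_of_fintype, ← Set.ncard_iUnion_of_finite]
    · refine Set.ncard_le_ncard ?_
      rintro e he
      obtain ⟨q, s, x, y, hu, hx, hy⟩ := Set.mem_iUnion.1 he
      have hs : F.ends e = s(x, y) := hu.2.1
      by_cases hxU : x ∈ ⋃ j, (X j).inner
      · obtain ⟨j, hj⟩ := Set.mem_iUnion.1 hxU
        refine ⟨x, y, hs, .inl ⟨j, q, ?_, hj, hy⟩⟩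
        rintro rfl
        exact hx hj
      · exact ⟨y, x, hs.trans Sym2.eq_swap, .inr ⟨q, hy, hxU⟩⟩
    · exact fun _ => Set.toFinite _
    · exact fun i j hij => h.disjoint_edgesUsedInto (hX.2 i j hij)
  calc _ ≤ ∑ q, (((edgesUsedInto T π (X q).inner).ncard : ℤ) + (F.inDegreeBi (X q) : ℤ)) :=
        Finset.sum_le_sum fun q _ => h1 q
    _ ≤ _ := by
        rw [Finset.sum_add_distrib]
        have : ((∑ q, (edgesUsedInto T π (X q).inner).ncard : ℕ) : ℤ) ≤
          F.edgeCount (fun q => (X q).inner) := by exact_mod_cast h2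
        push_cast at this
        linarith

end Necessity

/-! ### Orientations covering an intersecting supermodular function -/

/-- `PartitionSum b G U n`: the set `U` has a partition into nonempty subsets of `G` over which the
values of `b` sum to `n`. -/
inductive PartitionSum (b : Set V → ℤ) (G : Set V) : Set V → ℤ → Prop
  | empty : PartitionSum b G ∅ 0
  | insert {U X : Set V} {n : ℤ} (h : PartitionSum b G U n) (hX : X.Nonempty) (hXG : X ⊆ G)
      (hd : Disjoint X U) : PartitionSum b G (X ∪ U) (b X + n)

namespace PartitionSum

variable {b : Set V → ℤ} {G : Set V}

theorem disjoint_union {U U' : Set V} {n n' : ℤ} (h : PartitionSum b G U n)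
    (h' : PartitionSum b G U' n') (hd : Disjoint U U') : PartitionSum b G (U ∪ U') (n + n') := by
  induction h with
  | empty => simpa using h'
  | insert h hX hXG hXU ih =>
    rw [Set.disjoint_union_left] at hd
    rw [Set.union_assoc, add_assoc]
    exact (ih hd.2).insert hX hXG (Set.disjoint_union_right.2 ⟨hXU, hd.1⟩)

/-- Uncrossing a partition with a single set `Y`: the members meeting `Y` are merged with it, one
after the other, and their intersections with `Y` are split off. -/
theorem uncross_set (hb : IsIntersectingSupermodularOn b G) {U Y : Set V} {n : ℤ}
    (h : PartitionSum b G U n) (hY : Y.Nonempty) (hYG : Y ⊆ G) :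
    ∃ n₁ n₂, PartitionSum b G (Y ∪ U) n₁ ∧ PartitionSum b G (Y ∩ U) n₂ ∧ b Y + n ≤ n₁ + n₂ := by
  induction h generalizing Y with
  | empty => exact ⟨b Y + 0, 0, empty.insert hY hYG (by simp), by simpa using empty, by simp⟩
  | @insert U X n h hX hXG hXU ih =>
    rcases (Y ∩ X).eq_empty_or_nonempty with hYX | hYX
    · obtain ⟨n₁, n₂, h₁, h₂, hle⟩ := ih hY hYG
      have hdis : Disjoint X (Y ∪ U) := Set.disjoint_union_right.2
        ⟨(Set.disjoint_iff_inter_eq_empty.2 hYX).symm, hXU⟩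
      refine ⟨b X + n₁, n₂, ?_, ?_, by linarith⟩
      · rw [Set.union_left_comm]
        exact h₁.insert hX hXG hdis
      · rw [Set.inter_union_distrib_left, hYX, Set.empty_union]
        exact h₂
    · obtain ⟨n₁, n₂, h₁, h₂, hle⟩ := ih (Y := Y ∪ X) (hY.mono Set.subset_union_left)
        (Set.union_subset hYG hXG)
      have hsup := hb Y X hYG hXG hYX
      refine ⟨n₁, b (Y ∩ X) + n₂, ?_, ?_, by linarith⟩
      · rw [← Set.union_assoc]
        exact h₁
      · rw [Set.union_inter_distrib_right, Set.disjoint_iff_inter_eq_empty.1 hXU,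
          Set.union_empty] at h₂
        rw [Set.inter_union_distrib_left]
        exact h₂.insert hYX (Set.inter_subset_left.trans hYG)
          (hXU.mono Set.inter_subset_right Set.inter_subset_right)

/-- The largest value of a partition is a fully supermodular function of the partitioned set. -/
theorem uncross (hb : IsIntersectingSupermodularOn b G) {U U' : Set V} {n n' : ℤ}
    (h : PartitionSum b G U n) (h' : PartitionSum b G U' n') :
    ∃ n₁ n₂, PartitionSum b G (U ∪ U') n₁ ∧ PartitionSum b G (U ∩ U') n₂ ∧ n + n' ≤ n₁ + n₂ := by
  induction h' with
  | empty => exact ⟨n, 0, by simpa using h, by simpa using empty, le_rfl⟩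
  | @insert U' Y n' h' hY hYG hYU ih =>
    obtain ⟨n₁, n₂, h₁, h₂, hle⟩ := ih
    obtain ⟨m₁, m₂, k₁, k₂, kle⟩ := h₁.uncross_set hb hY hYG
    have hYU' : Y ∩ U' = ∅ := Set.disjoint_iff_inter_eq_empty.1 hYU
    refine ⟨m₁, m₂ + n₂, ?_, ?_, by linarith⟩
    · rw [Set.union_left_comm]
      exact k₁
    · rw [Set.inter_union_distrib_left, hYU', Set.union_empty] at k₂
      rw [Set.inter_union_distrib_left, Set.inter_comm U Y]
      exact k₂.disjoint_union h₂ (hYU.mono Set.inter_subset_left Set.inter_subset_right)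

theorem exists_subpartition {U : Set V} {n : ℤ} (h : PartitionSum b G U n) :
    ∃ (t : ℕ) (X : Fin t → Set V), IsSubpartition X G ∧ ⋃ q, X q = U ∧ ∑ q, b (X q) = n := by
  induction h with
  | empty => exact ⟨0, Fin.elim0, ⟨fun i => i.elim0, fun i => i.elim0⟩, by simp, by simp⟩
  | @insert U Y n h hY hYG hYU ih =>
    obtain ⟨t, X, hX, rfl, rfl⟩ := ih
    rw [Set.disjoint_iUnion_right] at hYU
    refine ⟨t + 1, Fin.cons Y X, ⟨?_, ?_⟩, ?_, ?_⟩
    · intro i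
      refine Fin.cases ⟨hY, hYG⟩ (fun i => hX.1 i) i
    · intro i j
      refine Fin.cases ?_ (fun i => ?_) i <;> refine Fin.cases ?_ (fun j => ?_) j
      · simp
      · simpa using fun _ => hYU j
      · simpa using (hYU i).symm
      · simpa using hX.2 i j
    · ext v
      simp
    · simp [Fin.sum_univ_succ]

end PartitionSum

/-- The value `1` for a true proposition and `0` for a false one. -/
noncomputable def ind (P : Prop) : ℤ := open Classical in if P then 1 else 0

theorem ind_pos {P : Prop} (h : P) : ind P = 1 := if_pos h

theorem ind_neg {P : Prop} (h : ¬ P) : ind P = 0 := if_neg h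

theorem ncard_setOf_eq_sum [Fintype α] (P : α → Prop) :
    (({a | P a}.ncard : ℕ) : ℤ) = ∑ a, ind (P a) := by
  classical
  simp only [ind, Set.ncard_eq_toFinset_card', Finset.sum_boole]
  simp

/-- In any orientation an edge counted by `edgeCount` enters a member of the family or leaves its
union. -/
theorem edgeCount_le [Finite E] {tl hd : E → V} (ho : ∀ e, F.ends e = s(tl e, hd e))
    {t : ℕ} {X : Fin t → Set V} {G : Set V} (hX : IsSubpartition X G) :
    F.edgeCount X ≤ ∑ q, (entering Set.univ tl hd (X q)).ncard +
      {e | tl e ∈ ⋃ q, X q ∧ hd e ∉ ⋃ q, X q}.ncard := by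
  refine (Set.ncard_le_ncard (t := (⋃ q, entering Set.univ tl hd (X q)) ∪
    {e | tl e ∈ ⋃ q, X q ∧ hd e ∉ ⋃ q, X q}) ?_).trans ((Set.ncard_union_le _ _).trans
      (Nat.add_le_add_right (Set.ncard_iUnion_le_of_fintype _) _))
  rintro e ⟨x, y, hxy, h⟩
  have key : ∀ i, (tl e ∈ X i ∧ hd e ∉ X i) ∨ (hd e ∈ X i ∧ tl e ∉ X i) →
      e ∈ (⋃ q, entering Set.univ tl hd (X q)) ∪ {e | tl e ∈ ⋃ q, X q ∧ hd e ∉ ⋃ q, X q} := by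
    rintro i (⟨h1, h2⟩ | ⟨h1, h2⟩)
    · by_cases hU : hd e ∈ ⋃ q, X q
      · obtain ⟨j, hj⟩ := Set.mem_iUnion.1 hU
        have hij : i ≠ j := by
          rintro rfl
          exact h2 hj
        exact .inl (Set.mem_iUnion.2 ⟨j, trivial,
          fun ht => Set.disjoint_left.1 (hX.2 i j hij) h1 ht, hj⟩)
      · exact .inr ⟨Set.mem_iUnion.2 ⟨i, h1⟩, hU⟩
    · exact .inl (Set.mem_iUnion.2 ⟨i, trivial, h2, h1⟩)
  have hsep : ∃ i, (x ∈ X i ∧ y ∉ X i) := by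
    rcases h with ⟨i, j, hij, hxi, hyj⟩ | ⟨i, hxi, hy⟩
    · exact ⟨i, hxi, fun hyi => Set.disjoint_left.1 (hX.2 i j hij) hyi hyj⟩
    · exact ⟨i, hxi, fun hyi => hy (Set.mem_iUnion.2 ⟨i, hyi⟩)⟩
  obtain ⟨i, hi⟩ := hsep
  rw [ho, Sym2.eq_iff] at hxy
  rcases hxy with ⟨h1, h2⟩ | ⟨h1, h2⟩
  · exact key i (.inl ⟨h1 ▸ hi.1, h2 ▸ hi.2⟩)
  · exact key i (.inr ⟨h2 ▸ hi.1, h1 ▸ hi.2⟩)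

/-- Some of the free edges `R` of a partially oriented graph can be reversed, and the others kept, so
that all bounds hold. Here `w` accounts for the edges already reversed, and `P U n` expresses a
lower bound `n` on the excess of the edges leaving `U` that are reversed over those entering it. If
an edge can be neither kept nor reversed, then uncrossing the two violated bounds gives a bound
that is violated before its removal. -/
theorem exists_reversal {tl hd : E → V} {P : Set V → ℤ → Prop}
    (hP : ∀ U n U' n', P U n → P U' n' →
      ∃ n₁ n₂, P (U ∪ U') n₁ ∧ P (U ∩ U') n₂ ∧ n + n' ≤ n₁ + n₂)
    (R : Finset E) (w : Set V → ℤ) (hw : ∀ U U', w (U ∪ U') + w (U ∩ U') = w U + w U')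
    (h : ∀ U n, P U n → n ≤ (∑ e ∈ R, ind (tl e ∈ U ∧ hd e ∉ U)) + w U) :
    ∃ K ⊆ R, ∀ U n, P U n →
      n ≤ (∑ e ∈ K, (ind (tl e ∈ U) - ind (hd e ∈ U))) + w U := by
  classical
  induction R using Finset.induction_on generalizing w with
  | empty => exact ⟨∅, subset_rfl, by simpa using h⟩
  | @insert e R he ih =>
    simp only [Finset.sum_insert he] at h
    by_cases hkeep : ∀ U n, P U n → n ≤ (∑ e ∈ R, ind (tl e ∈ U ∧ hd e ∉ U)) + w U
    · obtain ⟨K, hKR, hK⟩ := ih w hw hkeep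
      exact ⟨K, hKR.trans (Finset.subset_insert e R), hK⟩
    -- reversing `e` adds its modular contribution to `w`
    by_cases hrev : ∀ U n, P U n → n ≤ (∑ e ∈ R, ind (tl e ∈ U ∧ hd e ∉ U)) +
        ((ind (tl e ∈ U) - ind (hd e ∈ U)) + w U)
    · obtain ⟨K, hKR, hK⟩ := ih (fun U => (ind (tl e ∈ U) - ind (hd e ∈ U)) + w U)
        (fun U U' => by
          have := hw U U'
          by_cases h1 : tl e ∈ U <;> by_cases h2 : tl e ∈ U' <;> by_cases h3 : hd e ∈ U <;>
            by_cases h4 : hd e ∈ U' <;> simp [ind, h1, h2, h3, h4] <;> linarith) hrev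
      refine ⟨insert e K, Finset.insert_subset_insert e hKR, fun U n hU => ?_⟩
      rw [Finset.sum_insert fun heK => he (hKR heK)]
      linarith [hK U n hU]
    · exfalso
      push Not at hkeep hrev
      obtain ⟨U, n, hU, hn⟩ := hkeep
      obtain ⟨U', n', hU', hn'⟩ := hrev
      obtain ⟨n₁, n₂, h₁, h₂, hle⟩ := hP U n U' n' hU hU'
      have a1 := h U n hU
      have a2 := h U' n' hU'
      have a3 := h _ _ h₁
      have a4 := h _ _ h₂
      have a5 := hw U U'
      have a6 : (∑ e ∈ R, ind (tl e ∈ U ∪ U' ∧ hd e ∉ U ∪ U')) +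
          (∑ e ∈ R, ind (tl e ∈ U ∩ U' ∧ hd e ∉ U ∩ U')) ≤
          (∑ e ∈ R, ind (tl e ∈ U ∧ hd e ∉ U)) +
          ∑ e ∈ R, ind (tl e ∈ U' ∧ hd e ∉ U') := by
        rw [← Finset.sum_add_distrib, ← Finset.sum_add_distrib]
        refine Finset.sum_le_sum fun f _ => ?_
        by_cases h1 : tl f ∈ U <;> by_cases h2 : tl f ∈ U' <;> by_cases h3 : hd f ∈ U <;>
            by_cases h4 : hd f ∈ U' <;> simp [ind, h1, h2, h3, h4]
      -- `e` leaves `U` and enters `U'`, so it contributes to neither the union nor the intersection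
      have b1 : tl e ∈ U ∧ hd e ∉ U := by
        by_contra hc
        rw [ind_neg hc] at a1
        linarith
      have b2 : tl e ∉ U' ∧ hd e ∈ U' := by
        by_cases h2 : tl e ∈ U' <;> by_cases h4 : hd e ∈ U' <;> simp [ind, h2, h4] at a2 hn' ⊢ <;>
          linarith
      rw [ind_pos b1] at a1
      rw [ind_neg fun hc => b2.1 hc.1] at a2
      rw [ind_neg b2.1, ind_pos b2.2] at hn'
      rw [ind_neg fun hc => hc.2 (Or.inr b2.2)] at a3
      rw [ind_neg fun hc => b2.1 hc.1.2] at a4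
      linarith

theorem exists_tail_head (F : MixedGraph V E A) :
    ∃ tl hd : E → V, ∀ e, F.ends e = s(tl e, hd e) := by
  have h : ∀ e, ∃ p : V × V, F.ends e = s(p.1, p.2) := fun e => by
    induction F.ends e with
    | _ x y => exact ⟨(x, y), rfl⟩
  choose p hp using h
  exact ⟨fun e => (p e).1, fun e => (p e).2, hp⟩

/-- Frank's theorem on orientations whose in-degrees cover an intersecting supermodular function. -/
theorem exists_orientation [Finite E] (F : MixedGraph V E A) {G : Set V} {h : Set V → ℤ}
    (hsup : IsIntersectingSupermodularOn h G)
    (hcut : ∀ (t : ℕ) (X : Fin t → Set V), IsSubpartition X G →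
      ∑ q, h (X q) ≤ (F.edgeCount X : ℤ)) :
    ∃ tl hd : E → V, (∀ e, F.ends e = s(tl e, hd e)) ∧
      ∀ X ⊆ G, X.Nonempty → h X ≤ ((entering Set.univ tl hd X).ncard : ℤ) := by
  have := Fintype.ofFinite E
  obtain ⟨tl, hd, ho⟩ := F.exists_tail_head
  set b : Set V → ℤ := fun X => h X - (entering Set.univ tl hd X).ncard with hb
  have hbsup : IsIntersectingSupermodularOn b G := fun X Y hX hY hXY => by
    have h1 := hsup X Y hX hY hXY
    have h2 := ncard_entering_submodular (Set.univ : Set E) tl hd X Y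
    zify at h2
    simp only [hb]
    linarith
  obtain ⟨K, -, hK⟩ := exists_reversal (tl := tl) (hd := hd) (P := PartitionSum b G)
    (fun U n U' n' hU hU' => hU.uncross hbsup hU') Finset.univ (fun _ => 0) (by simp) (by
      intro U n hU
      obtain ⟨t, X, hX, rfl, rfl⟩ := hU.exists_subpartition
      have h1 := hcut t X hX
      have h2 := F.edgeCount_le ho hX
      zify at h2
      rw [add_zero, ← ncard_setOf_eq_sum fun e => tl e ∈ ⋃ q, X q ∧ hd e ∉ ⋃ q, X q]
      simp only [hb, Finset.sum_sub_distrib]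
      linarith)
  classical
  refine ⟨fun e => if e ∈ K then hd e else tl e, fun e => if e ∈ K then tl e else hd e, ?_, ?_⟩
  · intro e
    by_cases he : e ∈ K <;> simp [he, ho, Sym2.eq_swap]
  · intro X hX hne
    have h1 := hK _ _ (PartitionSum.empty.insert hne hX (by simp))
    rw [Set.union_empty, add_zero, add_zero] at h1
    simp only [hb] at h1
    rw [sub_le_iff_le_add] at h1
    refine h1.trans (le_of_eq ?_)
    simp only [entering, Set.mem_univ, true_and]
    rw [ncard_setOf_eq_sum, ncard_setOf_eq_sum, ← Finset.univ_inter K,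
      ← Finset.sum_ite_mem, ← Finset.sum_add_distrib]
    refine Finset.sum_congr rfl fun e _ => ?_
    by_cases he : e ∈ K <;> by_cases h2 : tl e ∈ X <;> by_cases h3 : hd e ∈ X <;>
      simp [ind, he, h2, h3]

/-! ### Growing mixed arborescences -/

namespace Subgraph

theorem toSimpleGraph_adj {T : F.Subgraph} {x y : T.verts} :
    T.toSimpleGraph.Adj x y ↔ x ≠ y ∧ ∃ l ∈ T.labels, F.link l = s((x : V), (y : V)) := by
  rw [toSimpleGraph, SimpleGraph.fromRel_adj, Sym2.eq_swap (a := (y : V)), or_self]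

theorem Contains.exists_toSimpleGraph_walk {T : F.Subgraph} {x y : V} (p : F.Walk x y)
    (hp : T.Contains p) (hx : x ∈ T.verts) (hy : y ∈ T.verts) :
    ∃ q : T.toSimpleGraph.Walk ⟨x, hx⟩ ⟨y, hy⟩, q.support.map Subtype.val = p.support := by
  induction p with
  | nil => exact ⟨.nil, rfl⟩
  | @cons a b z l h p ih =>
    have hl : l ∈ T.labels := hp.2 l (by simp [Walk.labels])
    have hb := (mem_verts_of_step hl h).2
    obtain ⟨q, hq⟩ := ih ⟨fun w hw => hp.1 w (List.mem_cons_of_mem _ hw),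
      fun w hw => hp.2 w (List.mem_cons_of_mem _ hw)⟩ hb hy
    have hadj : T.toSimpleGraph.Adj ⟨a, hx⟩ ⟨b, hb⟩ :=
      toSimpleGraph_adj.2 ⟨fun hab => h.ne (congrArg Subtype.val hab), l, hl, h.link_eq⟩
    exact ⟨.cons hadj q, by simp [Walk.support, hq]⟩

/-- Mixed paths in a tree are determined by their ends. -/
theorem IsTree.path_unique {T : F.Subgraph} (hT : T.IsTree) {x y : V} {p q : F.Walk x y}
    (hp : p.IsPath) (hpT : T.Contains p) (hq : q.IsPath) (hqT : T.Contains q) : p = q := by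
  have hx := hpT.1 x p.start_mem_support
  have hy := hpT.1 y p.end_mem_support
  obtain ⟨p', hp'⟩ := hpT.exists_toSimpleGraph_walk p hx hy
  obtain ⟨q', hq'⟩ := hqT.exists_toSimpleGraph_walk q hx hy
  have h1 : p'.IsPath := (SimpleGraph.Walk.isPath_def _).2 (List.Nodup.of_map Subtype.val (hp' ▸ hp))
  have h2 : q'.IsPath := (SimpleGraph.Walk.isPath_def _).2 (List.Nodup.of_map Subtype.val (hq' ▸ hq))
  have h3 : p' = q' := (hT.2.existsUnique_path _ _).unique h1 h2
  exact Walk.eq_of_support_eq hT.1 p q hpT.2 hqT.2 (by rw [← hp', ← hq', h3])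

/-- A subgraph all of whose vertices are reachable from `r` and which has one vertex more than edges
and arcs is a mixed arborescence. -/
theorem isMixedArborescence_of_ncard [Finite V] [Finite E] [Finite A] {T : F.Subgraph} {r : V}
    (hr : r ∈ T.verts) (hreach : ∀ x ∈ T.verts, T.Reachable r x)
    (hcard : T.labels.ncard + 1 = T.verts.ncard) : T.IsMixedArborescence r := by
  have hconn : T.toSimpleGraph.Connected := by
    refine (SimpleGraph.connected_iff_exists_forall_reachable _).2 ⟨⟨r, hr⟩, ?_⟩
    rintro ⟨x, hx⟩
    obtain ⟨p, -, hp⟩ := hreach x hx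
    obtain ⟨q, -⟩ := hp.exists_toSimpleGraph_walk p hr hx
    exact ⟨q⟩
  -- the edges of the simple graph are among the images of the edges and arcs of `T`
  have hsub : Sym2.map Subtype.val '' T.toSimpleGraph.edgeSet ⊆ F.link '' T.labels := by
    rintro _ ⟨e, he, rfl⟩
    induction e with
    | _ x y =>
      obtain ⟨-, l, hl, hxy⟩ := toSimpleGraph_adj.1 ((SimpleGraph.mem_edgeSet _).1 he)
      exact ⟨l, hl, hxy⟩
  have h1 : T.toSimpleGraph.edgeSet.ncard ≤ (F.link '' T.labels).ncard := by
    rw [← Set.ncard_image_of_injective _ (Sym2.map.injective Subtype.val_injective)]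
    exact Set.ncard_le_ncard hsub
  have h2 : (F.link '' T.labels).ncard ≤ T.labels.ncard := Set.ncard_image_le
  have h3 := hconn.card_vert_le_card_edgeSet_add_one
  rw [Nat.card_coe_set_eq, Nat.card_coe_set_eq] at h3
  have htree : T.IsTree := by
    refine ⟨Set.injOn_of_ncard_image_eq (by omega), ?_⟩
    rw [SimpleGraph.isTree_iff_connected_and_card]
    refine ⟨hconn, ?_⟩
    rw [Nat.card_coe_set_eq, Nat.card_coe_set_eq]
    omega
  refine ⟨htree, fun x hx => ?_⟩
  obtain ⟨p, hp, hpT⟩ := hreach x hx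
  exact ⟨p, ⟨hp, hpT⟩, fun q hq => htree.path_unique hq.1 hq.2 hp hpT⟩

end Subgraph

/-- `Grown F r X L`: the vertex set `X` and the set `L` of edges and arcs arise from the single
vertex `r` by successively adding a new vertex together with a step to it. -/
inductive Grown (F : MixedGraph V E A) (r : V) : Set V → Set (E ⊕ A) → Prop
  | base : Grown F r {r} ∅
  | step {X : Set V} {L : Set (E ⊕ A)} {l : E ⊕ A} {x y : V} (h : Grown F r X L) (hx : x ∈ X)
      (hy : y ∉ X) (hl : F.Step l x y) : Grown F r (insert y X) (insert l L)

namespace Grown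

variable {r : V} {X : Set V} {L : Set (E ⊕ A)}

theorem root_mem (h : Grown F r X L) : r ∈ X := by
  induction h with
  | base => exact rfl
  | step _ _ _ _ ih => exact Or.inr ih

theorem mem_of_mem_link (h : Grown F r X L) {l : E ⊕ A} (hl : l ∈ L) {x : V}
    (hx : x ∈ F.link l) : x ∈ X := by
  induction h with
  | base => exact hl.elim
  | step _ hx' _ hs ih =>
    rcases hl with rfl | hl
    · rw [hs.link_eq, Sym2.mem_iff] at hx
      rcases hx with rfl | rfl
      exacts [Or.inr hx', Or.inl rfl]
    · exact Or.inr (ih hl)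

theorem ncard_add_one [Finite V] [Finite E] [Finite A] (h : Grown F r X L) :
    L.ncard + 1 = X.ncard := by
  induction h with
  | base => simp
  | @step X L l x y h hx hy hs ih =>
    have hl : l ∉ L := fun hl => hy (h.mem_of_mem_link hl (by rw [hs.link_eq]; simp))
    rw [Set.ncard_insert_of_notMem hl, Set.ncard_insert_of_notMem hy, ih]

theorem reflTransGen (h : Grown F r X L) {v : V} (hv : v ∈ X) :
    Relation.ReflTransGen (fun x y => ∃ l ∈ L, F.Step l x y) r v := by
  induction h generalizing v with
  | base => rw [Set.mem_singleton_iff.1 hv]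
  | @step X L l x y h hx hy hs ih =>
    have hmono : ∀ w ∈ X, Relation.ReflTransGen (fun x y => ∃ l' ∈ insert l L, F.Step l' x y) r w :=
      fun w hw => Relation.ReflTransGen.mono
        (fun a b ⟨l', hl', hab⟩ => ⟨l', Or.inr hl', hab⟩) _ _ (ih hw)
    rcases hv with rfl | hv
    exacts [(hmono x hx).tail ⟨l, Or.inl rfl, hs⟩, hmono v hv]

/-- The subgraph formed by the grown sets. -/
def toSubgraph (h : Grown F r X L) : F.Subgraph where
  verts := X
  edges := {e | Sum.inl e ∈ L}
  arcs := {a | Sum.inr a ∈ L}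
  ends_mem := fun _ he _ hx => h.mem_of_mem_link he hx
  tail_mem := fun _ ha => h.mem_of_mem_link ha (by simp [link])
  head_mem := fun _ ha => h.mem_of_mem_link ha (by simp [link])

theorem labels_toSubgraph (h : Grown F r X L) : h.toSubgraph.labels = L := by
  ext (e | a) <;> simp [Subgraph.labels, toSubgraph]

theorem isMixedArborescence [Finite V] [Finite E] [Finite A] (h : Grown F r X L) :
    h.toSubgraph.IsMixedArborescence r :=
  Subgraph.isMixedArborescence_of_ncard h.root_mem
    (fun x hx => Subgraph.reachable_of_reflTransGen h.root_mem (by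
      rw [h.labels_toSubgraph]
      exact h.reflTransGen hx))
    (by rw [h.labels_toSubgraph]; exact h.ncard_add_one)

end Grown

/-! ### Packing arborescences in the oriented graph -/

/-- The vertex sets `X` for which the cut condition of the strong component of `x` is required: `X`
meets the component, and its remaining vertices form a set without entering edges and arcs that
precedes the component. -/
structure IsCutSet (F : MixedGraph V E A) (x : V) (X : Set V) : Prop where
  subset_W : X ⊆ F.W {x}
  nonempty : (X ∩ F.strongClass x).Nonempty
  closed : ∀ w ∈ X, w ∉ F.strongClass x → ∀ v, F.Reachable v w → v ∈ X

theorem IsCutSet.union {x : V} {X Y : Set V} (hX : F.IsCutSet x X) (hY : F.IsCutSet x Y) :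
    F.IsCutSet x (X ∪ Y) where
  subset_W := Set.union_subset hX.subset_W hY.subset_W
  nonempty := hX.nonempty.mono (Set.inter_subset_inter_left _ Set.subset_union_left)
  closed := by
    rintro w (hw | hw) hwx v hv
    exacts [.inl (hX.closed w hw hwx v hv), .inr (hY.closed w hw hwx v hv)]

theorem IsCutSet.inter {x v : V} {X Y : Set V} (hX : F.IsCutSet x X) (hY : F.IsCutSet x Y)
    (hv : v ∈ F.strongClass x) (hvX : v ∈ X) (hvY : v ∈ Y) : F.IsCutSet x (X ∩ Y) where
  subset_W := Set.inter_subset_left.trans hX.subset_W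
  nonempty := ⟨v, ⟨hvX, hvY⟩, hv⟩
  closed w hw hwx v hv := ⟨hX.closed w hw.1 hwx v hv, hY.closed w hw.2 hwx v hv⟩

/-- A stage in the construction of a packing in the graph in which `l` is oriented from `tl l` to
`hd l`. The set `B v` consists of the roots whose arborescences contain the vertex `v`, the
arborescence of `s` has the edges and arcs `L s`, and `R` is the set of unused edges and arcs. -/
structure PartialPacking (F : MixedGraph V E A) (M : Matroid S) (π : S → V) (tl hd : E ⊕ A → V)
    (R : Set (E ⊕ A)) (B : V → Set S) (L : S → Set (E ⊕ A)) : Prop where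
  indep : ∀ v, M.Indep (B v)
  subset_preimage_W : ∀ v, B v ⊆ π ⁻¹' F.W {v}
  base_subset : ∀ v, π ⁻¹' {v} ⊆ B v
  grown : ∀ s, Grown F (π s) {v | s ∈ B v} (L s)
  disjoint : ∀ s s', s ≠ s' → Disjoint (L s) (L s')
  unused : ∀ s, Disjoint (L s) R
  cut : ∀ x X, F.IsCutSet x X →
    rankAt M π (F.W {x}) - rk M (⋃ v ∈ X, B v) ≤ (entering R tl hd X).ncard

section Packing

variable {M : Matroid S} {π : S → V} {tl hd : E ⊕ A → V} {R : Set (E ⊕ A)} {B : V → Set S}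
  {L : S → Set (E ⊕ A)}

/-- The cut condition holds with equality for `X`. -/
def IsTight (F : MixedGraph V E A) (M : Matroid S) (π : S → V) (tl hd : E ⊕ A → V)
    (R : Set (E ⊕ A)) (B : V → Set S) (x : V) (X : Set V) : Prop :=
  rankAt M π (F.W {x}) - rk M (⋃ v ∈ X, B v) = (entering R tl hd X).ncard

namespace PartialPacking

theorem iUnion_subset (h : F.PartialPacking M π tl hd R B L) {x : V} {X : Set V}
    (hX : X ⊆ F.W {x}) : ⋃ v ∈ X, B v ⊆ π ⁻¹' F.W {x} := by
  intro s hs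
  simp only [Set.mem_iUnion] at hs
  obtain ⟨v, hv, hs⟩ := hs
  exact mem_W_singleton.2 ((mem_W_singleton.1 (h.subset_preimage_W v hs)).trans (mem_W_singleton.1 (hX hv)))

theorem subset_closure [Finite S] (hM : M.E = Set.univ) (h : F.PartialPacking M π tl hd R B L)
    {w u : V} (hw : rankAt M π (F.W {w}) ≤ rk M (B w)) (hu : F.Reachable u w) :
    B u ⊆ M.closure (B w) := by
  refine Set.Subset.trans (fun s hs => ?_) (subset_closure_of_rk_le M hM (h.subset_preimage_W w) hw)
  exact mem_W_singleton.2 ((mem_W_singleton.1 (h.subset_preimage_W u hs)).trans hu)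

/-- If `B_X` is not spanned by `B_v`, for a tight set `X`, then some unused arc inside `X` still
allows an arborescence to grow. Otherwise the vertices of `X` with `B_u` spanned by `B_v` would
form a set violating the cut condition. -/
theorem exists_arc_of_isTight [Finite V] [Finite E] [Finite A] [Finite S] (hM : M.E = Set.univ)
    (hstep : ∀ l, F.Step l (tl l) (hd l)) (h : F.PartialPacking M π tl hd R B L) {x v : V}
    {X : Set V} (hcomp : ∀ w, F.Reachable w x → w ∉ F.strongClass x →
      rankAt M π (F.W {w}) ≤ rk M (B w))
    (hX : F.IsCutSet x X) (htight : F.IsTight M π tl hd R B x X) (hvX : v ∈ X)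
    (hv : v ∈ F.strongClass x) (hns : ¬ ⋃ u ∈ X, B u ⊆ M.closure (B v)) :
    ∃ l ∈ R, tl l ∈ X ∧ hd l ∈ X ∧ hd l ∈ F.strongClass x ∧ ¬ B (tl l) ⊆ M.closure (B (hd l)) := by
  by_contra! hno
  set Q : Set V := {u ∈ X | B u ⊆ M.closure (B v)} with hQ
  have hQX : Q ⊆ X := fun u hu => hu.1
  have hBQ : ⋃ u ∈ Q, B u ⊆ M.closure (B v) := Set.iUnion₂_subset fun u hu => hu.2
  have hcut : F.IsCutSet x Q := by
    refine ⟨hQX.trans hX.subset_W, ⟨v, ⟨hvX, M.subset_closure _ (by simp [hM])⟩, hv⟩, ?_⟩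
    intro w hw hwx u hu
    exact ⟨hX.closed w hw.1 hwx u hu,
      (h.subset_closure hM (hcomp w (mem_W_singleton.1 (hX.subset_W hw.1)) hwx) hu).trans
        (M.closure_subset_closure_of_subset_closure hw.2)⟩
  have hent : entering R tl hd Q ⊆ entering R tl hd X := by
    rintro l ⟨hl, ht, hh⟩
    refine ⟨hl, fun htX => ht ?_, hQX hh⟩
    by_cases hx : hd l ∈ F.strongClass x
    · exact ⟨htX, (hno l hl htX (hQX hh) hx).trans
        (M.closure_subset_closure_of_subset_closure hh.2)⟩
    · exact hcut.closed _ hh hx _ (hstep l).reachable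
  have h1 := h.cut x Q hcut
  have h2 : ((entering R tl hd Q).ncard : ℤ) ≤ (entering R tl hd X).ncard := by
    exact_mod_cast Set.ncard_le_ncard hent
  have h3 : ⋃ u ∈ X, B u ⊆ M.closure (⋃ u ∈ Q, B u) := by
    refine subset_closure_of_rk_le M hM (Set.biUnion_subset_biUnion_left hQX) ?_
    unfold IsTight at htight
    linarith
  exact hns (h3.trans (M.closure_subset_closure_of_subset_closure hBQ))

/-- Intersecting tight sets can be uncrossed, and then the closures of their root sets intersect in
the closure of the root set of the intersection. -/
theorem isTight_inter [Finite E] [Finite A] [Finite S] (hM : M.E = Set.univ)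
    (h : F.PartialPacking M π tl hd R B L) {x v : V} {X Y : Set V}
    (hX : F.IsCutSet x X) (hY : F.IsCutSet x Y) (hv : v ∈ F.strongClass x) (hvX : v ∈ X)
    (hvY : v ∈ Y) (tX : F.IsTight M π tl hd R B x X) (tY : F.IsTight M π tl hd R B x Y) :
    F.IsTight M π tl hd R B x (X ∩ Y) ∧
      M.closure (⋃ u ∈ X, B u) ∩ M.closure (⋃ u ∈ Y, B u) ⊆ M.closure (⋃ u ∈ X ∩ Y, B u) := by
  have h1 := h.cut x _ (hX.union hY)
  have h2 := h.cut x _ (hX.inter hY hv hvX hvY)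
  have h3 := ncard_entering_submodular R tl hd X Y
  have h4 := rk_inter_add_rk_union_le M (M.closure (⋃ u ∈ X, B u)) (M.closure (⋃ u ∈ Y, B u))
  rw [rk_closure, rk_closure] at h4
  have h5 : rk M (⋃ u ∈ X ∪ Y, B u) ≤
      rk M (M.closure (⋃ u ∈ X, B u) ∪ M.closure (⋃ u ∈ Y, B u)) := by
    refine rk_mono M ?_
    rw [Set.biUnion_union]
    exact Set.union_subset_union (M.subset_closure _ (by simp [hM]))
      (M.subset_closure _ (by simp [hM]))
  have h6 : ⋃ u ∈ X ∩ Y, B u ⊆ M.closure (⋃ u ∈ X, B u) ∩ M.closure (⋃ u ∈ Y, B u) :=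
    Set.subset_inter
      ((Set.biUnion_subset_biUnion_left Set.inter_subset_left).trans
        (M.subset_closure _ (by simp [hM])))
      ((Set.biUnion_subset_biUnion_left Set.inter_subset_right).trans
        (M.subset_closure _ (by simp [hM])))
  have h7 := rk_mono M h6
  unfold IsTight at *
  zify at h3
  exact ⟨by linarith, subset_closure_of_rk_le M hM h6 (by linarith)⟩

/-- If the vertices strictly preceding `x` have all their roots, but `x` has not, then some
arborescence can be extended to a vertex of the strong component of `x` without violating a cut
condition. -/
theorem exists_extension [Finite V] [Finite E] [Finite A] [Finite S] (hM : M.E = Set.univ)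
    (hstep : ∀ l, F.Step l (tl l) (hd l)) (h : F.PartialPacking M π tl hd R B L) {x : V}
    (hx : rk M (B x) < rankAt M π (F.W {x}))
    (hcomp : ∀ w, F.Reachable w x → w ∉ F.strongClass x → rankAt M π (F.W {w}) ≤ rk M (B w)) :
    ∃ l ∈ R, ∃ s ∈ B (tl l), hd l ∈ F.strongClass x ∧ s ∉ M.closure (B (hd l)) ∧
      ∀ X, F.IsCutSet x X → hd l ∈ X → tl l ∉ X → F.IsTight M π tl hd R B x X →
        s ∉ M.closure (⋃ v ∈ X, B v) := by
  set 𝒯 : Set (Set V) := {X | F.IsCutSet x X ∧ F.IsTight M π tl hd R B x X ∧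
    ∃ v ∈ X, v ∈ F.strongClass x ∧ ¬ ⋃ u ∈ X, B u ⊆ M.closure (B v)} with h𝒯
  have hW : F.W {x} ∈ 𝒯 := by
    have hrk : rk M (⋃ u ∈ F.W {x}, B u) = rankAt M π (F.W {x}) := by
      refine le_antisymm (rk_mono M (h.iUnion_subset subset_rfl)) (rk_mono M fun s hs => ?_)
      exact Set.mem_biUnion hs (h.base_subset _ rfl)
    refine ⟨⟨subset_rfl, ⟨x, subset_W _ rfl, mem_strongClass_self x⟩,
      fun w hw _ v hv => mem_W_of_reachable hv hw⟩, ?_, x, subset_W _ rfl, mem_strongClass_self x,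
      fun hsub => ?_⟩
    · have : entering R tl hd (F.W {x}) = ∅ := Set.eq_empty_iff_forall_notMem.2 fun l hl =>
        hl.2.1 (mem_W_of_reachable (hstep l).reachable hl.2.2)
      rw [IsTight, this, hrk]
      simp
    · have := rk_le_of_subset_closure M hsub
      rw [hrk] at this
      linarith
  obtain ⟨X, ⟨hX, tX, v, hvX, hv, hns⟩, hmin⟩ := 𝒯.toFinite.exists_minimal ⟨_, hW⟩
  obtain ⟨l, hl, htl, hhl, hlx, hBl⟩ := h.exists_arc_of_isTight hM hstep hcomp hX tX hvX hv hns
  obtain ⟨s, hs, hsc⟩ := Set.not_subset.1 hBl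
  refine ⟨l, hl, s, hs, hlx, hsc, fun Y hY hhY htY tY hsY => ?_⟩
  obtain ⟨t, hcl⟩ := h.isTight_inter hM hX hY hlx hhl hhY tX tY
  have hsX : s ∈ M.closure (⋃ u ∈ X, B u) :=
    M.subset_closure _ (by simp [hM]) (Set.mem_biUnion htl hs)
  have hmem : X ∩ Y ∈ 𝒯 := ⟨hX.inter hY hlx hhl hhY, t, hd l, ⟨hhl, hhY⟩, hlx, fun hsub =>
    hsc (M.closure_subset_closure_of_subset_closure hsub (hcl ⟨hsX, hsY⟩))⟩
  exact htY (hmin hmem Set.inter_subset_left htl).2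

/-- The arborescence of `s` is extended along `l`. The root sets of the vertex sets entered by `l`
gain one in rank if they are tight, which makes up for the lost arc. -/
theorem extend [Finite V] [Finite E] [Finite A] [Finite S] (hM : M.E = Set.univ)
    (hstep : ∀ l, F.Step l (tl l) (hd l)) (h : F.PartialPacking M π tl hd R B L) {x : V}
    {l : E ⊕ A} {s : S} (hl : l ∈ R) (hs : s ∈ B (tl l)) (hlx : hd l ∈ F.strongClass x)
    (hsc : s ∉ M.closure (B (hd l)))
    (hgood : ∀ X, F.IsCutSet x X → hd l ∈ X → tl l ∉ X → F.IsTight M π tl hd R B x X →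
      s ∉ M.closure (⋃ v ∈ X, B v)) :
    ∃ B' L', F.PartialPacking M π tl hd (R \ {l}) B' L' := by
  classical
  have hsB : s ∉ B (hd l) := fun hsB => hsc (M.subset_closure _ (by simp [hM]) hsB)
  have hmem : ∀ v s', s' ∈ Function.update B (hd l) (insert s (B (hd l))) v ↔
      s' ∈ B v ∨ (v = hd l ∧ s' = s) := by
    intro v s'
    by_cases hv : v = hd l
    · subst hv
      simp [or_comm]
    · simp [hv]
  have hsub : ∀ v, B v ⊆ Function.update B (hd l) (insert s (B (hd l))) v :=
    fun v s' hs' => (hmem v s').2 (.inl hs')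
  have hlL : ∀ s', l ∉ L s' := fun s' hl' => Set.disjoint_left.1 (h.unused s') hl' hl
  have hmemL : ∀ s' l', l' ∈ Function.update L s (insert l (L s)) s' ↔
      l' ∈ L s' ∨ (s' = s ∧ l' = l) := by
    intro s' l'
    by_cases hs' : s' = s
    · subst hs'
      simp [or_comm]
    · simp [hs']
  refine ⟨Function.update B (hd l) (insert s (B (hd l))), Function.update L s (insert l (L s)),
    ?_, ?_, ?_, ?_, ?_, ?_, ?_⟩
  · intro v
    by_cases hv : v = hd l
    · subst hv
      rw [Function.update_self, Matroid.insert_indep_iff]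
      exact ⟨h.indep _, fun _ => ⟨by simp [hM], hsc⟩⟩
    · rw [Function.update_of_ne hv]
      exact h.indep v
  · intro v s' hs'
    rcases (hmem v s').1 hs' with hs' | ⟨rfl, rfl⟩
    · exact h.subset_preimage_W v hs'
    · exact mem_W_singleton.2 ((mem_W_singleton.1 (h.subset_preimage_W _ hs)).trans (hstep l).reachable)
  · exact fun v => (h.base_subset v).trans (hsub v)
  · intro s'
    by_cases hs' : s' = s
    · subst hs'
      rw [Function.update_self]
      convert (h.grown s').step hs hsB (hstep l) using 1
      ext v
      simp [hmem, or_comm]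
    · rw [Function.update_of_ne hs']
      convert h.grown s' using 1
      ext v
      simp [hmem, hs']
  · intro s₁ s₂ hne
    rw [Set.disjoint_left]
    intro l' g₁ g₂
    rcases (hmemL _ _).1 g₁ with h₁ | ⟨rfl, rfl⟩ <;> rcases (hmemL _ _).1 g₂ with h₂ | ⟨rfl, h₂'⟩
    · exact Set.disjoint_left.1 (h.disjoint s₁ s₂ hne) h₁ h₂
    · exact hlL s₁ (h₂' ▸ h₁)
    · exact hlL s₂ h₂
    · exact hne rfl
  · intro s'
    rw [Set.disjoint_left]
    rintro l' hl' ⟨hR, hne⟩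
    rcases (hmemL _ _).1 hl' with hl' | ⟨-, rfl⟩
    · exact Set.disjoint_left.1 (h.unused s') hl' hR
    · exact hne rfl
  · intro y X hX
    have hcut := h.cut y X hX
    have hB : ⋃ v ∈ X, B v ⊆ ⋃ v ∈ X, Function.update B (hd l) (insert s (B (hd l))) v :=
      Set.iUnion₂_mono fun v _ => hsub v
    have hrk := rk_mono M hB
    by_cases hent : l ∈ entering R tl hd X
    · have hent' : entering (R \ {l}) tl hd X = entering R tl hd X \ {l} := by
        ext l'
        simp only [entering, Set.mem_sdiff, Set.mem_ofPred_eq, Set.mem_singleton_iff]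
        tauto
      have hcard := Set.ncard_sdiff_singleton_add_one hent (Set.toFinite _)
      rw [← hent'] at hcard
      zify at hcard
      obtain ⟨-, htX, hhX⟩ := hent
      -- an arc can only enter `X` inside the strong component of `y`
      have hly : hd l ∈ F.strongClass y := by
        by_contra hly
        exact htX (hX.closed _ hhX hly _ (hstep l).reachable)
      have hyx : F.strongClass y = F.strongClass x :=
        (strongClass_eq hly).symm.trans (strongClass_eq hlx)
      have hWyx : F.W {y} = F.W {x} := by rw [← W_strongClass, hyx, W_strongClass]
      have hX' : F.IsCutSet x X := ⟨hWyx ▸ hX.subset_W, hyx ▸ hX.nonempty, hyx ▸ hX.closed⟩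
      by_cases ht : F.IsTight M π tl hd R B x X
      · have h1 := rk_insert M hM (hgood X hX' hhX htX ht)
        have h2 : rk M (insert s (⋃ v ∈ X, B v)) ≤
            rk M (⋃ v ∈ X, Function.update B (hd l) (insert s (B (hd l))) v) :=
          rk_mono M (Set.insert_subset
            (Set.mem_biUnion hhX ((hmem _ _).2 (.inr ⟨rfl, rfl⟩))) hB)
        linarith
      · have h1 : rankAt M π (F.W {y}) - rk M (⋃ v ∈ X, B v) < (entering R tl hd X).ncard :=
          lt_of_le_of_ne hcut (hWyx ▸ ht)
        linarith
    · have hent' : entering (R \ {l}) tl hd X = entering R tl hd X := by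
        ext l'
        simp only [entering, Set.mem_sdiff, Set.mem_ofPred_eq, Set.mem_singleton_iff] at hent ⊢
        refine ⟨fun h => ⟨h.1.1, h.2⟩, fun h => ⟨⟨h.1, ?_⟩, h.2⟩⟩
        rintro rfl
        exact hent h
      rw [hent']
      linarith

theorem exists_complete [Finite V] [Finite E] [Finite A] [Finite S] (hM : M.E = Set.univ)
    (hstep : ∀ l, F.Step l (tl l) (hd l)) (h : F.PartialPacking M π tl hd R B L) :
    ∃ R' B' L', F.PartialPacking M π tl hd R' B' L' ∧
      ∀ v, rankAt M π (F.W {v}) ≤ rk M (B' v) := by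
  induction hn : R.ncard using Nat.strong_induction_on generalizing R B L with
  | _ n ih =>
    subst hn
    by_cases hall : ∀ v, rankAt M π (F.W {v}) ≤ rk M (B v)
    · exact ⟨R, B, L, h, hall⟩
    push Not at hall
    obtain ⟨x, hx, hmin⟩ := Set.exists_min_image {v | rk M (B v) < rankAt M π (F.W {v})}
      (fun v => (F.W {v}).ncard) (Set.toFinite _) hall
    obtain ⟨l, hl, s, hs, hlx, hsc, hgood⟩ := h.exists_extension hM hstep hx fun w hw hwx => by
      by_contra! hlt
      refine (hmin w hlt).not_gt (Set.ncard_lt_ncard ⟨fun u hu => ?_, fun hsub => hwx ?_⟩)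
      · exact mem_W_singleton.2 ((mem_W_singleton.1 hu).trans hw)
      · exact ⟨mem_W_singleton.1 (hsub (subset_W _ rfl)), hw⟩
    obtain ⟨B', L', h'⟩ := h.extend hM hstep hl hs hlx hsc hgood
    exact ih _ (Set.ncard_sdiff_singleton_lt_of_mem hl (Set.toFinite _)) h' rfl

end PartialPacking

/-- The packing theorem for digraphs: in the orientation given by `tl` and `hd` the cut conditions
suffice for a packing. -/
theorem exists_packing [Finite V] [Finite E] [Finite A] [Finite S] (hM : M.E = Set.univ)
    (hπ : IsMIndependent M π) (hstep : ∀ l, F.Step l (tl l) (hd l))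
    (hcut : ∀ x X, F.IsCutSet x X →
      rankAt M π (F.W {x}) - rankAt M π X ≤ (entering Set.univ tl hd X).ncard) :
    ∃ T : S → F.Subgraph, F.IsMaximalIndependentPacking M π T := by
  have h0 : F.PartialPacking M π tl hd Set.univ (fun v => π ⁻¹' {v}) (fun _ => ∅) := by
    refine ⟨hπ, fun v => Set.preimage_mono (subset_W _), fun v => subset_rfl, fun s => ?_, by simp,
      by simp, fun x X hX => ?_⟩
    · convert Grown.base (F := F) (r := π s) using 1
      ext v
      simp [eq_comm]
    · convert hcut x X hX using 2
      rw [← Set.preimage_iUnion₂, Set.biUnion_of_singleton]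
      rfl
  obtain ⟨R, B, L, h, hall⟩ := h0.exists_complete hM hstep
  refine ⟨fun s => (h.grown s).toSubgraph, fun s => (h.grown s).isMixedArborescence, ?_, ?_⟩
  · intro s s' hne
    have := Set.disjoint_left.1 (h.disjoint s s' hne)
    exact ⟨Set.disjoint_left.2 fun e he he' => this he he',
      Set.disjoint_left.2 fun a ha ha' => this ha ha'⟩
  · intro v
    change M.Indep (B v) ∧ ((B v).ncard : ℤ) = _
    refine ⟨h.indep v, ?_⟩
    rw [← rk_eq_ncard M (h.indep v)]
    exact le_antisymm (rk_mono M (h.subset_preimage_W v)) (hall v)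

end Packing

/-! ### Sufficiency of the cut condition -/

/-- Both ends of an edge lie in the same strong component. -/
theorem mem_strongClass_of_ends {x y : V} {e : E} (h : F.ends e = s(x, y)) :
    y ∈ F.strongClass x :=
  ⟨(show F.Step (Sum.inl e) x y from h).reachable,
    (show F.Step (Sum.inl e) y x from h.trans Sym2.eq_swap).reachable⟩

theorem le_coverFun_of_isCutSet [Finite V] (M : Matroid S) (π : S → V) {x : V} {X : Set V}
    (hX : F.IsCutSet x X) :
    rankAt M π (F.W {x}) - rankAt M π X - F.inDegree X ≤
      F.coverFun M π (F.strongClass x) (X ∩ F.strongClass x) := by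
  refine (coverFun_isGreatest F M π _ _).2
    ⟨X, X \ F.strongClass x, Set.inter_subset_left, ?_, ?_, ?_⟩
  · rw [W_strongClass]
    exact Set.sdiff_subset_sdiff_left hX.subset_W
  · rw [Set.sdiff_self_inter, W_eq_self]
    rintro v ⟨hv, hvx⟩ u hu
    exact ⟨hX.closed v hv hvx u hu, fun hux =>
      hvx ⟨hux.1.trans hu, mem_W_singleton.1 (hX.subset_W hv)⟩⟩
  · rw [W_strongClass]

theorem exists_packing_of_coverFun [Finite V] [Finite E] [Finite A] [Finite S] {M : Matroid S}
    (hM : M.E = Set.univ) {π : S → V} (hπ : IsMIndependent M π)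
    (hcut : ∀ C : F.Subgraph, C.IsStrongComponent → ∀ (t : ℕ) (X : Fin t → Set V),
      IsSubpartition X C.verts → ∑ q, F.coverFun M π C.verts (X q) ≤ (F.edgeCount X : ℤ)) :
    ∃ T : S → F.Subgraph, F.IsMaximalIndependentPacking M π T := by
  obtain ⟨tl₀, hd₀, ho₀⟩ := F.exists_tail_head
  have hor : ∀ U : Set V, ∃ tl hd : E → V, (∀ e, F.ends e = s(tl e, hd e)) ∧
      ((∃ x, U = F.strongClass x) → ∀ X ⊆ U, X.Nonempty →
        F.coverFun M π U X ≤ ((entering Set.univ tl hd X).ncard : ℤ)) := by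
    intro U
    by_cases hU : ∃ x, U = F.strongClass x
    · obtain ⟨x, rfl⟩ := hU
      obtain ⟨tl, hd, ho, h⟩ := F.exists_orientation
        (coverFun_intersectingSupermodular M π (component_isStrongComponent x))
        (hcut _ (component_isStrongComponent x))
      exact ⟨tl, hd, ho, fun _ => h⟩
    · exact ⟨tl₀, hd₀, ho₀, fun h => absurd h hU⟩
  choose tl hd ho hcover using hor
  -- every edge is oriented as in the orientation chosen for its own strong component
  set U : E → Set V := fun e => F.strongClass (tl₀ e) with hU
  refine exists_packing (tl := Sum.elim (fun e => tl (U e) e) F.tail)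
    (hd := Sum.elim (fun e => hd (U e) e) F.head) hM hπ ?_ ?_
  · rintro (e | a)
    exacts [ho (U e) e, ⟨rfl, rfl⟩]
  · intro x X hX
    set K := F.strongClass x with hK
    have h1 := le_coverFun_of_isCutSet M π hX
    have h2 := hcover K ⟨x, rfl⟩ (X ∩ K) Set.inter_subset_right hX.nonempty
    have h3 : Sum.inl '' entering Set.univ (tl K) (hd K) (X ∩ K) ∪
        Sum.inr '' entering Set.univ F.tail F.head X ⊆
        entering Set.univ (Sum.elim (fun e => tl (U e) e) F.tail)
          (Sum.elim (fun e => hd (U e) e) F.head) X := by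
      rintro _ (⟨e, ⟨-, ht, hh⟩, rfl⟩ | ⟨a, ⟨-, ht, hh⟩, rfl⟩)
      · have hUe : U e = K := by
          have hxe : hd K e ∈ F.strongClass x := hh.2
          have h4 : tl₀ e = hd K e ∨ hd₀ e = hd K e := by
            have h5 : s(tl₀ e, hd₀ e) = s(tl K e, hd K e) := (ho₀ e).symm.trans (ho K e)
            rcases Sym2.eq_iff.1 h5 with h | h
            exacts [.inr h.2, .inl h.1]
          rcases h4 with h4 | h4
          · rw [hU, hK]
            exact strongClass_eq (h4 ▸ hxe)
          · exact (strongClass_eq (mem_strongClass_of_ends (ho₀ e))).symm.trans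
              (strongClass_eq (h4 ▸ hxe))
        have htK : tl K e ∈ K := by
          have h4 := mem_strongClass_of_ends ((ho K e).trans Sym2.eq_swap)
          rwa [strongClass_eq hh.2] at h4
        refine ⟨trivial, ?_, ?_⟩
        · simp only [Sum.elim_inl, hUe]
          exact fun htX => ht ⟨htX, htK⟩
        · simp only [Sum.elim_inl, hUe]
          exact hh.1
      · exact ⟨trivial, ht, hh⟩
    have h4 := Set.ncard_le_ncard h3 (Set.toFinite _)
    rw [Set.ncard_union_eq (by
        rw [Set.disjoint_left]
        rintro _ ⟨e, -, rfl⟩ ⟨a, -, h⟩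
        cases h) (Set.toFinite _) (Set.toFinite _),
      Set.ncard_image_of_injective _ Sum.inl_injective,
      Set.ncard_image_of_injective _ Sum.inr_injective, ← inDegree_eq] at h4
    zify at h4
    linarith

end MixedGraph

theorem theorem1p6 {V E A S : Type*} [Finite V] [Finite E] [Finite A] [Finite S]
    (F : MixedGraph V E A) (M : Matroid S) (hM : M.E = Set.univ) (π : S → V) :
    List.TFAE [
      (∃ T : S → F.Subgraph, F.IsMaximalIndependentPacking M π T),
      (MixedGraph.IsMIndependent M π ∧
        ∀ C : F.Subgraph, C.IsStrongComponent → ∀ (t : ℕ) (X : Fin t → BiSet V),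
          MixedGraph.IsSubpartition (fun q => (X q).inner) C.verts →
          (∀ q, ∃ Y : Set V, Y ⊆ F.W C.verts \ C.verts ∧ (X q).outer \ (X q).inner = F.W Y) →
          ∑ q, (MixedGraph.rankAt M π (F.W C.verts) - MixedGraph.rankAt M π (X q).outer) ≤
            (F.edgeCount (fun q => (X q).inner) : ℤ) + ∑ q, (F.inDegreeBi (X q) : ℤ)),
      (MixedGraph.IsMIndependent M π ∧
        ∀ C : F.Subgraph, C.IsStrongComponent → ∀ (t : ℕ) (X : Fin t → Set V),
          MixedGraph.IsSubpartition X C.verts →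
          ∑ q, F.coverFun M π C.verts (X q) ≤ (F.edgeCount X : ℤ))] ∧
    ∀ C : F.Subgraph, C.IsStrongComponent →
      MixedGraph.IsIntersectingSupermodularOn (F.coverFun M π C.verts) C.verts := by
  refine ⟨?_, fun C hC => MixedGraph.coverFun_intersectingSupermodular M π hC⟩
  tfae_have 1 → 2 := by
    rintro ⟨T, hT⟩
    exact ⟨hT.isMIndependent, fun C hC t X hX hY => hT.sum_le hC X hX hY⟩
  tfae_have 2 → 3 := by
    rintro ⟨hπ, h⟩
    refine ⟨hπ, fun C hC t X hX => ?_⟩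
    have hmax := fun q => (MixedGraph.coverFun_isGreatest F M π C.verts (X q)).1
    choose O Y hXO hY hOY hval using hmax
    have := h C hC t (fun q => ⟨O q, X q, hXO q⟩) hX fun q => ⟨Y q, hY q, hOY q⟩
    have hd : ∀ q, F.inDegree (O q) = F.inDegreeBi ⟨O q, X q, hXO q⟩ := fun q =>
      MixedGraph.inDegree_outer (X := ⟨O q, X q, hXO q⟩) (hOY q)
    simp only [hval, hd, Finset.sum_sub_distrib] at this ⊢
    linarith
  tfae_have 3 → 1 := fun ⟨hπ, h⟩ => MixedGraph.exists_packing_of_coverFun hM hπ h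
  tfae_finish
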